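/- **Setting.** Let $R,R_f,R_q,L,M_g,L_r,L_s,M_s,U_s,\omega_s,U_f,T_1,\dots,T_4$ and $J_1,\dots,J_6$ be real numbers, let $\Delta=\tfrac32M_g^2-L_r(L_s+M_s+L)$, and assume that $R,R_f,R_q,L_r,L_s+M_s+L,\Delta,J_1,\dots,J_6$ are all nonzero. Let $K$ (stiffness) be a real symmetric $6\times6$ matrix and $D$ (friction) a real $6\times 6$ matrix. Put $J=\mathrm{diag}(J_1,\dots,J_6)$, $T=(T_1,T_2,T_3,T_4,0,0)^\top$, $\widetilde K_R=\mathrm{diag}(R^{-1},R^{-1},R_f^{-1},R_q^{-1})$, $\widetilde K_L=-\Delta^{-1}\mathrm{diag}(L_r,L_r,L_s+M_s+L,L_s+M_s+L)$, $\widetilde I_s(t)=\big(\tfrac{U_s}{R}\cos\omega_st,\tfrac{U_s}{R}\sin\omega_st,\tfrac{U_f}{R_f},0\big)^\top$ and $$\widetilde\Gamma(\theta)=\frac{\sqrt{3/2}\,M_g}{\Delta}\begin{pmatrix}0&0&\cos\theta_5&-\sin\theta_5\\0&0&\sin\theta_5&\cos\theta_5\\\cos\theta_5&\sin\theta_5&0&0\\-\sin\theta_5&\cos\theta_5&0&0\end{pmatrix}.$$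 The generator system, with unknown $x=(\dot{\widetilde\Psi};\widetilde\Psi;\dot\theta;\theta;t)\in\mathbb R^{4+4+6+6+1}$, is the port-Hamiltonian descriptor system $$M\dot x=(P-Q)z(x)+Nu(x),\qquad(1)$$ with $M=\mathrm{diag}(0,\widetilde K_L,J,E,1)$, $Q=\mathrm{diag}(\widetilde K_R,0,D,0,0)$, $N=\mathrm{diag}(I_4,0,I_6,0,1)$, $u(x)=(\widetilde I_s(t);0;T;0;1)$, $$P=\begin{pmatrix}0&-\widetilde K_L&0&0&0\\\widetilde K_L&0&0&0&0\\0&0&0&-E&0\\0&0&E&0&0\\0&0&0&0&0\end{pmatrix},\qquad z(x)=\begin{pmatrix}\dot{\widetilde\Psi}\\\widetilde K_L^{-1}(\widetilde K_L+\widetilde\Gamma(\theta))\widetilde\Psi\\\dot\theta\\E^{-1}\big(K\theta+\tfrac12(\widetilde\Psi^\top\partial_{\theta_5}\widetilde\Gamma(\theta)\widetilde\Psi)\,e_5\big)\\0\end{pmatrix},$$ where $e_5$ is the fifth unit vector of $\mathbb R^6$ and $E$ is an invertible symmetric real $6\times6$ matrix. One may take $E=K$ if $K$ is invertible; for the stiffness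 matrix of a free shaft (a chain of six masses joined by springs), which has zero row sums and hence is singular, one may take $E=I_6$. Let $s\ge1$, let $\gamma_1,\dots,\gamma_s$ be the zeros of $\frac{d^s}{dx^s}\big(x^s(x-1)^s\big)$, let $\ell_1,\dots,\ell_s$ be the Lagrange polynomials for these nodes, and let $a_{ij}=\int_0^{\gamma_i}\ell_j$, $b_j=\int_0^1\ell_j$. A step of size $h$ of the $s$-stage Gauss method for (1) goes from $x_n$ to $x_{n+1}=x_n+h\sum_jb_jk_j$, where $k_1,\dots,k_s\in\mathbb R^{21}$ satisfy $$Mk_i=(P-Q)z\Big(x_n+h\sum_ja_{ij}k_j\Big)+Nu\Big(x_n+h\sum_ja_{ij}k_j\Big),\qquad i=1,\dots,s.$$ **Theorem 1.** Let $T_m>0$, let $x_0$ be consistent initial values (time component $0$ and $\widetilde K_R\dot{\widetilde\Psi}_0+(\widetilde K_L+\widetilde\Gamma(\theta_0))\widetilde\Psi_0=\widetilde I_s(0)$), and let $x(t)$ be a solution of (1) on $[0,T_m]$ with $x(0)=x_0$. Then there are $h_0>0$ and $C$ such that for all $0<h\le h_0$ and all $n\ge 0$ with $t_n=nh\le T_m$,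 $n$ steps of the $s$-stage Gauss method can be carried out from $x_0$, and every result $x_n=(\dot{\widetilde\Psi}_n;\widetilde\Psi_n;\dot\theta_n;\theta_n;t_n)$ satisfies $$\|\widetilde\Psi_n-\widetilde\Psi(t_n)\|,\ \|\dot\theta_n-\dot\theta(t_n)\|,\ \|\theta_n-\theta(t_n)\|\le Ch^{2s},\qquad \|\dot{\widetilde\Psi}_n-\dot{\widetilde\Psi}(t_n)\|\le\begin{cases}Ch^{s},&s\text{ even},\\Ch^{s+1},&s\text{ odd}.\end{cases}$$ -/

import Mathlib

open scoped Matrix Polynomial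

noncomputable section

namespace Generator

/-- Data of the generator system. -/
structure Params where
  /-- line resistance, and resistances of the excitation and the damper winding -/
  (R Rf Rq : ℝ)
  /-- line inductance -/
  L : ℝ
  /-- inductance parameters of the generator -/
  (Mg Lr Ls Ms : ℝ)
  /-- amplitude and angular frequency of the AC source, excitation voltage -/
  (Us ωs Uf : ℝ)
  /-- moments of inertia of the six mass blocks -/
  inertia : Fin 6 → ℝ
  /-- stiffness matrix of the shaft -/
  K : Matrix (Fin 6) (Fin 6) ℝ
  /-- friction matrix of the shaft -/
  D : Matrix (Fin 6) (Fin 6) ℝ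
  /-- mechanical torques acting on the first four mass blocks -/
  torque : Fin 4 → ℝ

namespace Params

variable (p : Params)

/-- The denominator `3/2 M² - L_r (L_s + M_s + L)`. -/
def Δ : ℝ := 3 / 2 * p.Mg ^ 2 - p.Lr * (p.Ls + p.Ms + p.L)

/-- The quantities the model divides by do not vanish, and the stiffness matrix is symmetric. -/
structure Admissible : Prop where
  R_ne : p.R ≠ 0
  Rf_ne : p.Rf ≠ 0
  Rq_ne : p.Rq ≠ 0
  Lr_ne : p.Lr ≠ 0
  sum_ne : p.Ls + p.Ms + p.L ≠ 0
  Δ_ne : p.Δ ≠ 0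
  inertia_ne : ∀ i, p.inertia i ≠ 0
  K_symm : p.K.IsSymm

/-- Inertia matrix `J`. -/
def J : Matrix (Fin 6) (Fin 6) ℝ := Matrix.diagonal p.inertia

/-- Torque vector `T`. -/
def T : Fin 6 → ℝ := ![p.torque 0, p.torque 1, p.torque 2, p.torque 3, 0, 0]

/-- Resistance matrix `K̃_R`; flux linkages are ordered `(Ψ_{1α}, Ψ_{1β}, Ψ_f, Ψ_q)`. -/
def KR : Matrix (Fin 4) (Fin 4) ℝ := Matrix.diagonal ![p.R⁻¹, p.R⁻¹, p.Rf⁻¹, p.Rq⁻¹]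

/-- Inductance matrix `K̃_L`. -/
def KL : Matrix (Fin 4) (Fin 4) ℝ :=
  p.Δ⁻¹ • Matrix.diagonal
    ![-p.Lr, -p.Lr, -(p.Ls + p.Ms + p.L), -(p.Ls + p.Ms + p.L)]

/-- Magnetic coupling matrix `Γ̃`, as a function of the rotor angle `φ = θ₅`, the only
component of `θ` it depends on. -/
def Γ (φ : ℝ) : Matrix (Fin 4) (Fin 4) ℝ :=
  (√(3 / 2) * p.Mg / p.Δ) •
    !![0, 0, Real.cos φ, -Real.sin φ;
       0, 0, Real.sin φ, Real.cos φ;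
       Real.cos φ, Real.sin φ, 0, 0;
       -Real.sin φ, Real.cos φ, 0, 0]

/-- The entrywise derivative `∂Γ̃/∂θ₅`. -/
def dΓ (φ : ℝ) : Matrix (Fin 4) (Fin 4) ℝ :=
  Matrix.of fun i j => deriv (fun ψ => p.Γ ψ i j) φ

/-- Injected currents `Ĩ_s(t)`. -/
def Is (t : ℝ) : Fin 4 → ℝ :=
  ![p.Us / p.R * Real.cos (p.ωs * t), p.Us / p.R * Real.sin (p.ωs * t), p.Uf / p.Rf, 0]

/-- The vector `Ψ̃ᵀ (∂Γ̃(θ)/∂θ) Ψ̃`, whose only nonzero component is the fifth. -/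
def torqueForm (Ψ : Fin 4 → ℝ) (θ : Fin 6 → ℝ) : Fin 6 → ℝ :=
  ![0, 0, 0, 0, Ψ ⬝ᵥ (p.dΓ (θ 4) *ᵥ Ψ), 0]

end Params

/-- Indices of the 21 components of the state `x = (dΨ̃/dt; Ψ̃; dθ/dt; θ; t)`. -/
abbrev Idx : Type := (Fin 4 ⊕ Fin 4) ⊕ ((Fin 6 ⊕ Fin 6) ⊕ Unit)

abbrev State : Type := Idx → ℝ

/-- Column vector with the given five blocks. -/
def col (a b : Fin 4 → ℝ) (c d : Fin 6 → ℝ) (e : ℝ) : State :=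
  Sum.elim (Sum.elim a b) (Sum.elim (Sum.elim c d) fun _ => e)

namespace State

variable (x : State)

/-- Block `dΨ̃/dt` of the state. -/
def dPsi : Fin 4 → ℝ := fun i => x (.inl (.inl i))

/-- Block `Ψ̃` of the state. -/
def Psi : Fin 4 → ℝ := fun i => x (.inl (.inr i))

/-- Block `dθ/dt` of the state. -/
def dTheta : Fin 6 → ℝ := fun i => x (.inr (.inl (.inl i)))

/-- Block `θ` of the state. -/
def Theta : Fin 6 → ℝ := fun i => x (.inr (.inl (.inr i)))

/-- Time component of the state. -/
def time : ℝ := x (.inr (.inr ()))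

end State

/-! The port-Hamiltonian descriptor form. The equation `dθ/dt = ω` enters it multiplied by an
invertible symmetric matrix `E`. If the stiffness matrix `K` is invertible one may take `E = K`;
the stiffness matrix of a free shaft (a chain of springs) has zero row sums, so is singular,
and there one takes for instance `E = 1`. -/

section Descriptor

variable (p : Params) (E : Matrix (Fin 6) (Fin 6) ℝ)

/-- `M = diag(0, K̃_L, J, E, 1)`. -/
def mM : Matrix Idx Idx ℝ :=
  .fromBlocks (.fromBlocks 0 0 0 p.KL) 0 0
    (.fromBlocks (.fromBlocks p.J 0 0 E) 0 0 1)

def mP : Matrix Idx Idx ℝ :=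
  .fromBlocks (.fromBlocks 0 (-p.KL) p.KL 0) 0 0
    (.fromBlocks (.fromBlocks 0 (-E) E 0) 0 0 0)

/-- `Q = diag(K̃_R, 0, D, 0, 0)`. -/
def mQ : Matrix Idx Idx ℝ :=
  .fromBlocks (.fromBlocks p.KR 0 0 0) 0 0
    (.fromBlocks (.fromBlocks p.D 0 0 0) 0 0 0)

/-- `N = diag(I₄, 0, I₆, 0, 1)`. -/
def mN : Matrix Idx Idx ℝ :=
  .fromBlocks (.fromBlocks 1 0 0 0) 0 0
    (.fromBlocks (.fromBlocks 1 0 0 0) 0 0 1)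

def mV : Matrix Idx Idx ℝ := 0

/-- The effort `z(x)`. -/
def z (x : State) : State :=
  col x.dPsi
    (p.KL⁻¹ *ᵥ ((p.KL + p.Γ (x.Theta 4)) *ᵥ x.Psi))
    x.dTheta
    (E⁻¹ *ᵥ (p.K *ᵥ x.Theta + (1 / 2 : ℝ) • p.torqueForm x.Psi x.Theta))
    0

/-- The input `u(x)`. -/
def u (x : State) : State := col (p.Is x.time) 0 p.T 0 1

/-- Right-hand side `(P - Q) z(x) + (N - V) u(x)`. -/
def rhs (x : State) : State :=
  (mP p E - mQ p) *ᵥ z p E x + (mN - mV) *ᵥ u p x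

/-- `X` solves `M ẋ = (P - Q) z(x) + (N - V) u(x)` on `[0, Tm]`. -/
def IsSolution (Tm : ℝ) (X : ℝ → State) : Prop :=
  ∀ t ∈ Set.Icc 0 Tm, ∃ v : State,
    HasDerivWithinAt X v (Set.Icc 0 Tm) t ∧ mM p E *ᵥ v = rhs p E (X t)

/-- Consistent initial values at time `0`: the algebraic equation
`K̃_R dΨ̃/dt + (K̃_L + Γ̃(θ)) Ψ̃ = Ĩ_s(t)` holds. -/
def IsConsistent (x : State) : Prop :=
  x.time = 0 ∧
    p.KR *ᵥ x.dPsi + (p.KL + p.Γ (x.Theta 4)) *ᵥ x.Psi = p.Is x.time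

end Descriptor

section Collocation

variable {s : ℕ} (γ : Fin s → ℝ)

/-- `γ` lists the `s` distinct zeros of the shifted Legendre polynomial
`dˢ/dxˢ (xˢ (x - 1)ˢ)`, which has degree `s`. -/
def IsGaussNodes : Prop :=
  Function.Injective γ ∧
    ∀ i, (Polynomial.derivative^[s] ((Polynomial.X : ℝ[X]) ^ s * (Polynomial.X - 1) ^ s)).eval
      (γ i) = 0

/-- `a_{ij} = ∫₀^{γ_i} ℓ_j`. -/
def collA (i j : Fin s) : ℝ :=
  ∫ τ in (0 : ℝ)..(γ i), (Lagrange.basis Finset.univ γ j).eval τ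

/-- `b_i = ∫₀¹ ℓ_i`. -/
def collB (i : Fin s) : ℝ :=
  ∫ τ in (0 : ℝ)..1, (Lagrange.basis Finset.univ γ i).eval τ

/-- One step of size `h` of the collocation method, from `x` to `x'`. -/
def IsStep (p : Params) (E : Matrix (Fin 6) (Fin 6) ℝ) (h : ℝ) (x x' : State) : Prop :=
  ∃ k : Fin s → State,
    (∀ i, mM p E *ᵥ k i = rhs p E (x + h • ∑ j, collA γ i j • k j)) ∧
      x' = x + h • ∑ j, collB γ j • k j

/-- `xs 0, …, xs n` is produced from `x0` by `n` steps of size `h` of the method. -/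
def IsNumericalSolution (p : Params) (E : Matrix (Fin 6) (Fin 6) ℝ) (h : ℝ) (x0 : State)
    (n : ℕ) (xs : ℕ → State) : Prop :=
  xs 0 = x0 ∧ ∀ m < n, IsStep γ p E h (xs m) (xs (m + 1))

end Collocation

end Generator

end

/-!
Inverting the regular blocks turns the descriptor system into a smooth ordinary differential
equation `v' = field v` for `v = (Ψ̃, dθ/dt, θ, t)`, and `dΨ̃/dt` is the first component of
`field v`. The stages of the Gauss method solve the same algebraic equation, so on `v` the method
is the Gauss collocation method for this ordinary differential equation.

A collocation step has local error `O(h ^ (2 s + 1))`: tested against an approximate solution of the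
adjoint variational equation (a Picard iterate), the error at the end of the step becomes the
integral of a function that has a Taylor expansion uniform in `h` and nearly vanishes at the nodes,
and Gauss quadrature is exact up to degree `2 s - 1`. Gronwall's inequality then gives the order
`2 s` for `v`.

The method replaces `dΨ̃/dt` by `(-1) ^ s` times the old value plus a weighted sum of the stage
values. This is an extrapolation of degree `s`, with error `O(h ^ (s + 1))`. For even `s` these
errors may accumulate to `O(h ^ s)`; for odd `s` the errors of two consecutive steps cancel up to
`O(h ^ (s + 2))`, which saves one order.
-/

noncomputable section

namespace Generator

open Polynomial

section Primitive

/-- The primitive of a real polynomial that vanishes at `0`; it turns the integrals that define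
the coefficients of a collocation method into values of polynomials. -/
def primitive (p : ℝ[X]) : ℝ[X] := p.sum fun k a => monomial (k + 1) (a / (k + 1))

lemma derivative_primitive (p : ℝ[X]) : derivative (primitive p) = p := by
  conv_rhs => rw [← p.sum_monomial_eq]
  rw [primitive, Polynomial.sum, Polynomial.sum, derivative_sum]
  refine Finset.sum_congr rfl fun k _ => ?_
  rw [derivative_monomial]
  congr 1
  push_cast
  field_simp

lemma eval_zero_primitive (p : ℝ[X]) : (primitive p).eval 0 = 0 := by
  rw [primitive, Polynomial.sum, eval_finsetSum]
  exact Finset.sum_eq_zero fun k _ => by simp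

lemma natDegree_primitive_le (p : ℝ[X]) : (primitive p).natDegree ≤ p.natDegree + 1 :=
  natDegree_sum_le_of_forall_le _ _ fun k hk =>
    (natDegree_monomial_le _).trans (Nat.succ_le_succ (le_natDegree_of_mem_supp k hk))

lemma integral_eval (p : ℝ[X]) (x : ℝ) :
    ∫ τ in (0 : ℝ)..x, p.eval τ = (primitive p).eval x := by
  conv_lhs => rw [← derivative_primitive p]
  rw [intervalIntegral.integral_eq_sub_of_hasDerivAt (fun τ _ => (primitive p).hasDerivAt τ)
    ((Polynomial.continuous _).intervalIntegrable _ _), eval_zero_primitive, sub_zero]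

lemma integral_eval_mul_derivative (p q : ℝ[X]) (a b : ℝ) :
    ∫ τ in a..b, p.eval τ * (derivative q).eval τ =
      p.eval b * q.eval b - p.eval a * q.eval a -
        ∫ τ in a..b, (derivative p).eval τ * q.eval τ :=
  intervalIntegral.integral_mul_deriv_eq_deriv_mul (fun x _ => p.hasDerivAt x)
    (fun x _ => q.hasDerivAt x) ((derivative p).continuous.intervalIntegrable _ _)
    ((derivative q).continuous.intervalIntegrable _ _)

lemma integral_eval_pos {p : ℝ[X]} (hp : p ≠ 0) (hpos : ∀ τ ∈ Set.Icc (0 : ℝ) 1, 0 ≤ p.eval τ) :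
    0 < ∫ τ in (0 : ℝ)..1, p.eval τ := by
  obtain ⟨τ, hτ, hroot⟩ : ∃ τ ∈ Set.Ioo (0 : ℝ) 1, τ ∉ (p.roots.toFinset : Set ℝ) :=
    ((Set.Ioo_infinite one_pos).sdiff (Finset.finite_toSet _)).nonempty
  have hne : p.eval τ ≠ 0 := fun h => hroot (by simpa [hp] using h)
  have hmem := Set.Ioo_subset_Icc_self hτ
  exact intervalIntegral.integral_pos zero_lt_one p.continuous.continuousOn
    (fun x hx => hpos x (Set.Ioc_subset_Icc_self hx)) ⟨τ, hmem, (hpos τ hmem).lt_of_ne' hne⟩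

end Primitive

section Legendre

/-- The polynomial `dˢ/dxˢ (xˢ (x - 1)ˢ)`, a multiple of the shifted Legendre polynomial of
degree `s`, whose zeros are the Gauss nodes. -/
def rodrigues (s : ℕ) : ℝ[X] := derivative^[s] ((X : ℝ[X]) ^ s * (X - 1) ^ s)

lemma eval_iterate_derivative_pow_mul (t : ℝ) (n : ℕ) (q : ℝ[X]) :
    (derivative^[n] ((X - C t) ^ n * q)).eval t = n.factorial * q.eval t := by
  rw [iterate_derivative_mul, eval_finsetSum,
    Finset.sum_eq_single_of_mem 0 (Finset.mem_range.mpr n.succ_pos)]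
  · simp [iterate_derivative_X_sub_pow_self]
  · intro i hi h0
    have hpos : n - (n - i) ≠ 0 := by
      have := Finset.mem_range.mp hi
      omega
    rw [iterate_derivative_X_sub_pow]
    simp [hpos]

lemma eval_iterate_derivative_of_pow_dvd {t : ℝ} {n k : ℕ} (hk : k < n) {p : ℝ[X]}
    (hp : (X - C t) ^ n ∣ p) : (derivative^[k] p).eval t = 0 := by
  refine eval_eq_zero_of_dvd_of_eval_eq_zero (pow_sub_dvd_iterate_derivative_of_pow_dvd k hp) ?_
  simp [Nat.sub_ne_zero_of_lt hk]

lemma eval_zero_rodrigues (s : ℕ) : (rodrigues s).eval 0 = (-1) ^ s * s.factorial := by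
  have h := eval_iterate_derivative_pow_mul 0 s ((X - 1) ^ s)
  rw [C_0, sub_zero] at h
  rw [rodrigues, h]
  simp [mul_comm]

lemma eval_one_rodrigues (s : ℕ) : (rodrigues s).eval 1 = s.factorial := by
  have h := eval_iterate_derivative_pow_mul 1 s (X ^ s)
  rw [C_1] at h
  rw [rodrigues, mul_comm, h]
  simp

lemma natDegree_rodrigues_le (s : ℕ) : (rodrigues s).natDegree ≤ s := by
  have h : ((X : ℝ[X]) ^ s * (X - C 1) ^ s).natDegree = s + s := by
    rw [(monic_X_pow s).natDegree_mul ((monic_X_sub_C 1).pow s), natDegree_X_pow,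
      (monic_X_sub_C 1).natDegree_pow, natDegree_X_sub_C, mul_one]
  refine (natDegree_iterate_derivative _ _).trans ?_
  rw [C_1] at h
  omega

lemma integral_mul_iterate_derivative {s k : ℕ} (hk : k ≤ s) {p : ℝ[X]} (hp : p.natDegree < k) :
    ∫ τ in (0 : ℝ)..1, p.eval τ *
      (derivative^[k] ((X : ℝ[X]) ^ s * (X - 1) ^ s)).eval τ = 0 := by
  induction k generalizing p with
  | zero => omega
  | succ k ih =>
    have h0 : (derivative^[k] ((X : ℝ[X]) ^ s * (X - 1) ^ s)).eval 0 = 0 :=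
      eval_iterate_derivative_of_pow_dvd hk (by simp)
    have h1 : (derivative^[k] ((X : ℝ[X]) ^ s * (X - 1) ^ s)).eval 1 = 0 :=
      eval_iterate_derivative_of_pow_dvd hk (by simp)
    rw [Function.iterate_succ_apply', integral_eval_mul_derivative, h0, h1]
    rcases Nat.eq_zero_or_pos p.natDegree with hd | hd
    · rw [eq_C_of_natDegree_eq_zero hd]
      simp
    · rw [ih (by omega) ((natDegree_derivative_lt hd.ne').trans_le (by omega))]
      simp

lemma integral_mul_rodrigues {s : ℕ} {p : ℝ[X]} (hp : p.natDegree < s) :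
    ∫ τ in (0 : ℝ)..1, p.eval τ * (rodrigues s).eval τ = 0 :=
  integral_mul_iterate_derivative le_rfl hp

end Legendre

section Nodes

open Lagrange (nodal)

variable {s : ℕ} {γ : Fin s → ℝ}

lemma natDegree_nodal_univ (γ : Fin s → ℝ) : (nodal Finset.univ γ).natDegree = s := by
  rw [Lagrange.natDegree_nodal, Finset.card_univ, Fintype.card_fin]

lemma IsGaussNodes.exists_rodrigues_eq (hγ : IsGaussNodes γ) :
    ∃ c : ℝ, c ≠ 0 ∧ rodrigues s = C c * nodal Finset.univ γ := by
  have hne : rodrigues s ≠ 0 := by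
    intro h
    have := eval_one_rodrigues s
    rw [h, eval_zero] at this
    exact Nat.factorial_ne_zero s (by exact_mod_cast this.symm)
  have hdvd : nodal Finset.univ γ ∣ rodrigues s := by
    refine Finset.prod_dvd_of_coprime (fun i _ j _ hij => ?_) fun i _ =>
      dvd_iff_isRoot.mpr (hγ.2 i)
    exact isCoprime_X_sub_C_of_isUnit_sub (sub_ne_zero.mpr (hγ.1.ne hij)).isUnit
  obtain ⟨r, hr⟩ := hdvd
  have hr0 : r ≠ 0 := fun h => hne (by rw [hr, h, mul_zero])
  have hdeg : r.natDegree = 0 := by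
    have h := natDegree_rodrigues_le s
    rw [hr, natDegree_mul Lagrange.nodal_ne_zero hr0, natDegree_nodal_univ] at h
    omega
  have hrC := eq_C_of_natDegree_eq_zero hdeg
  refine ⟨r.coeff 0, fun h => hr0 (by rw [hrC, h, C_0]), ?_⟩
  rw [← hrC, hr, mul_comm]

lemma IsGaussNodes.integral_mul_nodal (hγ : IsGaussNodes γ) {p : ℝ[X]} (hp : p.natDegree < s) :
    ∫ τ in (0 : ℝ)..1, (p * nodal Finset.univ γ).eval τ = 0 := by
  obtain ⟨c, hc, h⟩ := hγ.exists_rodrigues_eq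
  have horth := integral_mul_rodrigues hp
  rw [h] at horth
  simp only [eval_mul, eval_C, mul_left_comm _ c, intervalIntegral.integral_const_mul] at horth
  simpa only [eval_mul] using (mul_eq_zero.mp horth).resolve_left hc

lemma IsGaussNodes.eval_one_nodal (hγ : IsGaussNodes γ) :
    (nodal Finset.univ γ).eval 1 = (-1) ^ s * (nodal Finset.univ γ).eval 0 := by
  obtain ⟨c, hc, h⟩ := hγ.exists_rodrigues_eq
  have h0 := eval_zero_rodrigues s
  have h1 := eval_one_rodrigues s
  rw [h, eval_mul, eval_C] at h0 h1
  refine mul_left_cancel₀ hc ?_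
  rw [mul_left_comm, h0, h1, ← mul_assoc, ← mul_pow]
  simp

lemma IsGaussNodes.mem_Ioo (hγ : IsGaussNodes γ) (i : Fin s) : γ i ∈ Set.Ioo (0 : ℝ) 1 := by
  set q := nodal (Finset.univ.erase i) γ with hq
  have hq0 : q ≠ 0 := Lagrange.nodal_ne_zero
  have hdeg : q.natDegree < s := by
    rw [hq, Lagrange.natDegree_nodal, Finset.card_erase_of_mem (Finset.mem_univ i),
      Finset.card_univ, Fintype.card_fin]
    exact Nat.sub_lt i.pos one_pos
  have horth : ∫ τ in (0 : ℝ)..1, ((X - C (γ i)) * q ^ 2).eval τ = 0 := by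
    have h := hγ.integral_mul_nodal hdeg
    rwa [Lagrange.nodal_eq_mul_nodal_erase (Finset.mem_univ i), ← hq,
      show q * ((X - C (γ i)) * q) = (X - C (γ i)) * q ^ 2 by ring] at h
  constructor
  · by_contra! hle
    refine (integral_eval_pos (mul_ne_zero (X_sub_C_ne_zero (γ i)) (pow_ne_zero 2 hq0))
      fun τ hτ => ?_).ne' horth
    simpa using mul_nonneg (sub_nonneg.mpr (hle.trans hτ.1)) (sq_nonneg (q.eval τ))
  · by_contra! hle
    have hpos := integral_eval_pos (p := -((X - C (γ i)) * q ^ 2))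
      (neg_ne_zero.mpr (mul_ne_zero (X_sub_C_ne_zero (γ i)) (pow_ne_zero 2 hq0))) fun τ hτ => by
        simpa [← neg_mul] using mul_nonneg (sub_nonneg.mpr (hτ.2.trans hle)) (sq_nonneg (q.eval τ))
    simp only [eval_neg, intervalIntegral.integral_neg, horth, neg_zero, lt_irrefl] at hpos

end Nodes

section Collocation

open Lagrange (nodal)

variable {s : ℕ} {γ : Fin s → ℝ}

/-- The primitives of the Lagrange basis polynomials for the nodes `γ`. Their values at the nodes
and at `1` are the coefficients `a_{ij}` and `b_j` of the collocation method. -/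
def collPoly (γ : Fin s → ℝ) (j : Fin s) : ℝ[X] := primitive (Lagrange.basis Finset.univ γ j)

lemma collA_eq (γ : Fin s → ℝ) (i j : Fin s) : collA γ i j = (collPoly γ j).eval (γ i) :=
  integral_eval _ _

lemma collB_eq (γ : Fin s → ℝ) (j : Fin s) : collB γ j = (collPoly γ j).eval 1 :=
  integral_eval _ _

lemma eval_zero_collPoly (γ : Fin s → ℝ) (j : Fin s) : (collPoly γ j).eval 0 = 0 :=
  eval_zero_primitive _

lemma derivative_collPoly (γ : Fin s → ℝ) (j : Fin s) :
    derivative (collPoly γ j) = Lagrange.basis Finset.univ γ j := derivative_primitive _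

lemma natDegree_basis_univ_lt (hγ : Function.Injective γ) (j : Fin s) :
    (Lagrange.basis Finset.univ γ j).natDegree < s := by
  rw [Lagrange.natDegree_basis hγ.injOn (Finset.mem_univ j), Finset.card_univ, Fintype.card_fin]
  exact Nat.sub_lt j.pos one_pos

lemma natDegree_collPoly_le (hγ : Function.Injective γ) (j : Fin s) :
    (collPoly γ j).natDegree ≤ s :=
  (natDegree_primitive_le _).trans (natDegree_basis_univ_lt hγ j)

lemma eq_sum_basis (hγ : Function.Injective γ) {p : ℝ[X]} (hp : p.degree < s) :
    p = ∑ j, C (p.eval (γ j)) * Lagrange.basis Finset.univ γ j := by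
  rw [← Lagrange.interpolate_apply]
  exact Lagrange.eq_interpolate hγ.injOn (by simpa using hp)

lemma natDegree_sum_pow_mul_basis_le (hγ : Function.Injective γ) (k : ℕ) :
    (∑ j, C (γ j ^ k) * Lagrange.basis Finset.univ γ j).natDegree ≤ k := by
  rcases lt_or_ge k s with hk | hk
  · have h := eq_sum_basis hγ (p := X ^ k) (by simpa using hk)
    simp only [eval_pow, eval_X] at h
    rw [← h, natDegree_X_pow]
  · exact natDegree_sum_le_of_forall_le _ _ fun j _ => (natDegree_C_mul_le _ _).trans
      ((natDegree_basis_univ_lt hγ j).le.trans hk)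

lemma eq_sum_collPoly (hγ : Function.Injective γ) {p : ℝ[X]} (hp : p.natDegree ≤ s) :
    p = C (p.eval 0) + ∑ j, C ((derivative p).eval (γ j)) * collPoly γ j := by
  set q := C (p.eval 0) + ∑ j, C ((derivative p).eval (γ j)) * collPoly γ j with hq
  have hdeg : (derivative p).degree < s := by
    rcases eq_or_ne p 0 with rfl | hp0
    · simp
    · exact (degree_derivative_lt hp0).trans_le (degree_le_of_natDegree_le hp)
  have hder : derivative (p - q) = 0 := by
    rw [derivative_sub, sub_eq_zero, hq]
    simpa only [derivative_add, derivative_C, zero_add, derivative_sum, derivative_C_mul,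
      derivative_collPoly] using eq_sum_basis hγ hdeg
  have hconst := eq_C_of_natDegree_eq_zero (derivative_eq_zero.mp hder)
  have h0 : (p - q).eval 0 = 0 := by simp [hq, eval_finsetSum, eval_zero_collPoly]
  rw [hconst, eval_C] at h0
  rw [h0, C_0] at hconst
  exact sub_eq_zero.mp hconst

lemma sum_collPoly_mul_pow (hγ : Function.Injective γ) {k : ℕ} (hk : k < s) (τ : ℝ) :
    ∑ j, (collPoly γ j).eval τ * γ j ^ k = τ ^ (k + 1) / (k + 1) := by
  have h := congrArg (eval τ) (eq_sum_collPoly hγ (p := X ^ (k + 1)) (by simpa using hk))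
  simp only [eval_pow, eval_X, derivative_X_pow, eval_add, eval_C, eval_finsetSum, eval_mul,
    ne_eq, Nat.add_eq_zero_iff, one_ne_zero, and_false, not_false_eq_true, zero_pow, zero_add,
    Nat.add_sub_cancel] at h
  rw [h, Finset.sum_div]
  refine Finset.sum_congr rfl fun j _ => ?_
  push_cast
  field_simp

lemma integral_eq_sum_collB_mul (hγ : Function.Injective γ) {p : ℝ[X]} (hp : p.natDegree < s) :
    ∫ τ in (0 : ℝ)..1, p.eval τ = ∑ j, collB γ j * p.eval (γ j) := by
  have h := congrArg (eval 1)
    (eq_sum_collPoly hγ ((natDegree_primitive_le p).trans (Nat.succ_le_of_lt hp)))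
  simp only [derivative_primitive, eval_zero_primitive, C_0, zero_add, eval_finsetSum, eval_mul,
    eval_C, ← collB_eq] at h
  simp only [integral_eval, h, mul_comm]

lemma IsGaussNodes.integral_eq_sum_collB_mul (hγ : IsGaussNodes γ) {p : ℝ[X]}
    (hp : p.natDegree < 2 * s) :
    ∫ τ in (0 : ℝ)..1, p.eval τ = ∑ j, collB γ j * p.eval (γ j) := by
  set N := nodal Finset.univ γ with hN
  have hmon : N.Monic := Lagrange.nodal_monic
  have hNdeg : N.natDegree = s := natDegree_nodal_univ γ
  have hN1 : N ≠ 1 := fun h => by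
    rw [h, natDegree_one] at hNdeg
    omega
  have hdiv : ∀ τ, p.eval τ = (p %ₘ N).eval τ + (p /ₘ N * N).eval τ := fun τ => by
    rw [← eval_add, mul_comm, modByMonic_add_div p N]
  have hrem : (p %ₘ N).natDegree < s := hNdeg ▸ natDegree_modByMonic_lt p hmon hN1
  have hquot : (p /ₘ N).natDegree < s := by
    rw [natDegree_divByMonic p hmon, hNdeg]
    omega
  calc ∫ τ in (0 : ℝ)..1, p.eval τ
      = ∫ τ in (0 : ℝ)..1, ((p %ₘ N).eval τ + (p /ₘ N * N).eval τ) := by simp only [← hdiv]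
    _ = ∫ τ in (0 : ℝ)..1, (p %ₘ N).eval τ := by
      rw [intervalIntegral.integral_add ((Polynomial.continuous _).intervalIntegrable _ _)
        ((Polynomial.continuous _).intervalIntegrable _ _), hγ.integral_mul_nodal hquot, add_zero]
    _ = ∑ j, collB γ j * p.eval (γ j) := by
      rw [Generator.integral_eq_sum_collB_mul hγ.1 hrem]
      simp [hdiv, hN, Lagrange.eval_nodal_at_node]

lemma IsGaussNodes.sum_collB_mul_pow (hγ : IsGaussNodes γ) {k : ℕ} (hk : k < 2 * s) :
    ∑ j, collB γ j * γ j ^ k = 1 / (k + 1) := by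
  have h := hγ.integral_eq_sum_collB_mul (p := X ^ k) (by simpa using hk)
  simpa using h.symm

/-- The Runge–Kutta matrix `(a_{ij})` of the collocation method with nodes `γ`. -/
def collMatrix (γ : Fin s → ℝ) : Matrix (Fin s) (Fin s) ℝ := Matrix.of (collA γ)

lemma isUnit_det_collMatrix (hγ : Function.Injective γ) (h0 : ∀ i, γ i ≠ 0) :
    IsUnit (collMatrix γ).det := by
  rw [isUnit_iff_ne_zero]
  intro hdet
  obtain ⟨k, hk0, hk⟩ := Matrix.exists_mulVec_eq_zero_iff.mpr hdet
  set p : ℝ[X] := ∑ j, C (k j) * collPoly γ j with hp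
  have hdeg : p.natDegree ≤ s :=
    natDegree_sum_le_of_forall_le _ _ fun j _ =>
      (natDegree_C_mul_le _ _).trans (natDegree_collPoly_le hγ j)
  have hroot : ∀ i, p.eval (γ i) = 0 := fun i => by
    simpa [hp, eval_finsetSum, ← collA_eq, Matrix.mulVec, dotProduct, collMatrix, mul_comm]
      using congrFun hk i
  have hroot0 : p.eval 0 = 0 := by simp [hp, eval_finsetSum, eval_zero_collPoly]
  have hp0 : p = 0 := by
    refine eq_zero_of_natDegree_lt_card_of_eval_eq_zero' p (insert 0 (Finset.univ.image γ))
      (by simpa [hroot0] using hroot) ?_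
    rw [Finset.card_insert_of_notMem (by simpa using h0), Finset.card_image_of_injective _ hγ]
    simpa using Nat.lt_succ_of_le hdeg
  have hder : ∑ j, C (k j) * Lagrange.basis Finset.univ γ j = 0 := by
    simpa [hp, derivative_collPoly] using congrArg derivative hp0
  refine hk0 (funext fun i => ?_)
  have hi := congrArg (eval (γ i)) hder
  rw [eval_finsetSum, Finset.sum_eq_single_of_mem i (Finset.mem_univ i) fun j _ hj => by
    rw [eval_mul, Lagrange.eval_basis_of_ne hj (Finset.mem_univ i), mul_zero]] at hi
  simpa [Lagrange.eval_basis_self hγ.injOn (Finset.mem_univ i)] using hi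

lemma exists_sum_collA_smul_eq {F : Type*} [AddCommGroup F] [Module ℝ F]
    (hγ : Function.Injective γ) (h0 : ∀ i, γ i ≠ 0) (Y : Fin s → F) :
    ∃ k : Fin s → F, ∀ i, ∑ j, collA γ i j • k j = Y i := by
  have hmul := Matrix.mul_nonsing_inv _ (isUnit_det_collMatrix hγ h0)
  refine ⟨fun j => ∑ l, (collMatrix γ)⁻¹ j l • Y l, fun i => ?_⟩
  calc ∑ j, collA γ i j • ∑ l, (collMatrix γ)⁻¹ j l • Y l
      = ∑ l, (∑ j, collMatrix γ i j * (collMatrix γ)⁻¹ j l) • Y l := by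
        simp only [Finset.smul_sum, Finset.sum_smul, smul_smul]
        exact Finset.sum_comm
    _ = ∑ l, (1 : Matrix (Fin s) (Fin s) ℝ) i l • Y l := by simp only [← hmul, Matrix.mul_apply]
    _ = Y i := by simp [Matrix.one_apply]

/-- The weights `w = bᵀ A⁻¹` through which a stiffly treated component of a Runge–Kutta method is
extrapolated from its stages. -/
def extrapolationWeights (γ : Fin s → ℝ) : Fin s → ℝ := collB γ ᵥ* (collMatrix γ)⁻¹

lemma IsGaussNodes.ne_zero (hγ : IsGaussNodes γ) (i : Fin s) : γ i ≠ 0 := (hγ.mem_Ioo i).1.ne'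

lemma IsGaussNodes.sum_extrapolationWeights_mul_collA (hγ : IsGaussNodes γ) (j : Fin s) :
    ∑ i, extrapolationWeights γ i * collA γ i j = collB γ j := by
  have h : extrapolationWeights γ ᵥ* collMatrix γ = collB γ := by
    rw [extrapolationWeights, Matrix.vecMul_vecMul,
      Matrix.nonsing_inv_mul _ (isUnit_det_collMatrix hγ.1 hγ.ne_zero), Matrix.vecMul_one]
  exact congrFun h j

lemma IsGaussNodes.eval_one_eq (hγ : IsGaussNodes γ) {p : ℝ[X]} (hp : p.natDegree ≤ s) :
    p.eval 1 = (1 - ∑ i, extrapolationWeights γ i) * p.eval 0 +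
      ∑ i, extrapolationWeights γ i * p.eval (γ i) := by
  have heval : ∀ τ, p.eval τ =
      p.eval 0 + ∑ j, (derivative p).eval (γ j) * (collPoly γ j).eval τ := fun τ => by
    simpa [eval_finsetSum] using congrArg (eval τ) (eq_sum_collPoly hγ.1 hp)
  have hsum : ∑ i, extrapolationWeights γ i * ∑ j, (derivative p).eval (γ j) * collA γ i j =
      ∑ j, (derivative p).eval (γ j) * collB γ j := by
    simp only [Finset.mul_sum, ← hγ.sum_extrapolationWeights_mul_collA]
    rw [Finset.sum_comm]
    exact Finset.sum_congr rfl fun j _ => Finset.sum_congr rfl fun i _ => by ring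
  simp only [heval 1, heval (γ _), ← collB_eq, ← collA_eq, mul_add, Finset.sum_add_distrib, hsum,
    ← Finset.sum_mul]
  ring

lemma IsGaussNodes.one_sub_sum_extrapolationWeights (hγ : IsGaussNodes γ) :
    1 - ∑ i, extrapolationWeights γ i = (-1) ^ s := by
  have h0 : (nodal Finset.univ γ).eval 0 ≠ 0 :=
    Lagrange.eval_nodal_not_at_node fun i _ => (hγ.ne_zero i).symm
  have h := hγ.eval_one_eq (natDegree_nodal_univ γ).le
  simp only [hγ.eval_one_nodal, Lagrange.eval_nodal_at_node (Finset.mem_univ _), mul_zero,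
    Finset.sum_const_zero, add_zero] at h
  exact (mul_right_cancel₀ h0 h).symm

lemma IsGaussNodes.neg_one_pow_mul_zero_pow_add (hγ : IsGaussNodes γ) {k : ℕ} (hk : k ≤ s) :
    (-1) ^ s * 0 ^ k + ∑ i, extrapolationWeights γ i * γ i ^ k = 1 := by
  have h := hγ.eval_one_eq (p := X ^ k) (by simpa using hk)
  simpa [hγ.one_sub_sum_extrapolationWeights] using h.symm

end Collocation

end Generator

namespace Generator

open Asymptotics Filter Set
open scoped ContDiff Topology

lemma isBigO_comp_fst {ι β E F : Type*} [Norm E] [Norm F] {u : ι → E} {v : ι → F}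
    (huv : u =O[⊤] v) : (fun x : ι × β => u x.1) =O[⊤] fun x => v x.1 :=
  huv.comp_tendsto Filter.tendsto_top

lemma isBigO_comp_prodMk {ι β E F : Type*} [Norm E] [Norm F] {u : ι × β → E} {v : ι × β → F}
    (huv : u =O[⊤] v) (b : β) : (fun i => u (i, b)) =O[⊤] fun i => v (i, b) :=
  huv.comp_tendsto (k := fun i => (i, b)) (l' := ⊤) Filter.tendsto_top

section Expansion

variable {ι E F G : Type*} [NormedAddCommGroup E] [NormedSpace ℝ E] [NormedAddCommGroup F]
  [NormedSpace ℝ F] [NormedAddCommGroup G] [NormedSpace ℝ G] {h : ι → ℝ} {m n : ℕ}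

lemma isBigO_clm_apply₂ (B : E →L[ℝ] F →L[ℝ] G) {l : Filter ι} {u : ι → E} {v : ι → F}
    {a b : ι → ℝ} (hu : u =O[l] a) (hv : v =O[l] b) :
    (fun i => B (u i) (v i)) =O[l] fun i => a i * b i :=
  B.isBoundedBilinearMap.isBigO_comp.trans (hu.norm_left.mul hv.norm_left)

lemma isBigO_pow_pow (hh : h =O[⊤] fun _ => (1 : ℝ)) (hmn : m ≤ n) :
    (fun i => h i ^ n) =O[⊤] fun i => h i ^ m := by
  obtain ⟨k, rfl⟩ := Nat.exists_eq_add_of_le hmn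
  simpa [pow_add] using (isBigO_refl (fun i => h i ^ m) ⊤).mul (hh.pow k)

lemma isBigO_unitInterval : (fun x : ι × Icc (0 : ℝ) 1 => (x.2 : ℝ)) =O[⊤] fun _ => (1 : ℝ) :=
  isBigO_of_le _ fun x => by simpa [abs_of_nonneg x.2.2.1] using x.2.2.2

lemma isBigO_eval_unitInterval (p : ℝ[X]) :
    (fun x : ι × Icc (0 : ℝ) 1 => p.eval (x.2 : ℝ)) =O[⊤] fun _ => (1 : ℝ) := by
  obtain ⟨C, hC⟩ := (isCompact_Icc (a := (0 : ℝ)) (b := 1)).exists_bound_of_continuousOn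
    p.continuous.continuousOn
  exact isBigO_top.mpr ⟨C, fun x => by simpa using hC x.2 x.2.2⟩

lemma isBigO_mul_unitInterval_pow_smul {v : ι → ℝ} {c : ι → E} (hc : c =O[⊤] v) (k : ℕ) :
    (fun x : ι × Icc (0 : ℝ) 1 => (h x.1 * x.2) ^ k • c x.1) =O[⊤] fun x => h x.1 ^ k * v x.1 := by
  have hpow := (isBigO_refl (fun x : ι × Icc (0 : ℝ) 1 => h x.1 ^ k) ⊤).mul
    (isBigO_unitInterval.pow k)
  simpa [mul_pow] using hpow.smul (isBigO_comp_fst hc)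

/-- The functions `g i` on `[0, 1]` have expansions `∑ k < m, (h i * τ) ^ k • q k i + O(h i ^ m)`
with bounded coefficients, uniformly in the parameter `i`. This is how a function that is smooth on
the physical time scale looks after rescaling a step of size `h i` to `[0, 1]`. -/
def HasUnifExpansion (h : ι → ℝ) (m : ℕ) (g : ι → ℝ → E) : Prop :=
  ∃ q : ℕ → ι → E, (∀ k, q k =O[⊤] fun _ => (1 : ℝ)) ∧
    (fun x : ι × Icc (0 : ℝ) 1 =>
      g x.1 x.2 - ∑ k ∈ Finset.range m, (h x.1 * x.2) ^ k • q k x.1) =O[⊤] fun x => h x.1 ^ m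

namespace HasUnifExpansion

lemma of_isBigO {g : ι → ℝ → E}
    (hg : (fun x : ι × Icc (0 : ℝ) 1 => g x.1 x.2) =O[⊤] fun x => h x.1 ^ m) :
    HasUnifExpansion h m g :=
  ⟨0, fun _ => isBigO_zero _ _, by simpa using hg⟩

lemma congr {g g' : ι → ℝ → E} (hg : HasUnifExpansion h m g) (hgg' : ∀ i τ, g i τ = g' i τ) :
    HasUnifExpansion h m g' := by
  rwa [← show g = g' from funext₂ hgg']

lemma monomial (hh : h =O[⊤] fun _ => (1 : ℝ)) {c : ι → E} (hc : c =O[⊤] fun _ => (1 : ℝ))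
    (m k : ℕ) : HasUnifExpansion h m fun i τ => (h i * τ) ^ k • c i := by
  rcases lt_or_ge k m with hk | hk
  · refine ⟨Pi.single k c, fun l => ?_, ?_⟩
    · rcases eq_or_ne l k with rfl | hl
      · simpa using hc
      · rw [Pi.single_eq_of_ne hl]
        exact isBigO_zero _ _
    · have hsum : ∀ x : ι × Icc (0 : ℝ) 1, ∑ l ∈ Finset.range m,
          (h x.1 * x.2) ^ l • (Pi.single k c : ℕ → ι → E) l x.1 = (h x.1 * x.2) ^ k • c x.1 := by
        intro x
        rw [Finset.sum_eq_single_of_mem k (Finset.mem_range.mpr hk) fun l _ hl => by simp [hl]]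
        simp
      simpa only [hsum, sub_self] using isBigO_zero (E' := E) _ _
  · refine of_isBigO ((isBigO_mul_unitInterval_pow_smul hc k).trans ?_)
    simpa only [mul_one] using isBigO_comp_fst (isBigO_pow_pow hh hk)

lemma const (hh : h =O[⊤] fun _ => (1 : ℝ)) {c : ι → E} (hc : c =O[⊤] fun _ => (1 : ℝ)) (m : ℕ) :
    HasUnifExpansion h m fun i _ => c i := by
  simpa using monomial hh hc m 0

lemma add {g g' : ι → ℝ → E} (hg : HasUnifExpansion h m g) (hg' : HasUnifExpansion h m g') :
    HasUnifExpansion h m fun i τ => g i τ + g' i τ := by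
  obtain ⟨q, hq, hr⟩ := hg
  obtain ⟨q', hq', hr'⟩ := hg'
  refine ⟨q + q', fun k => (hq k).add (hq' k), (hr.add hr').congr_left fun x => ?_⟩
  simp only [Pi.add_apply, smul_add, Finset.sum_add_distrib]
  abel

lemma sum {J : Type*} {A : Finset J} {g : J → ι → ℝ → E}
    (hg : ∀ j ∈ A, HasUnifExpansion h m (g j)) :
    HasUnifExpansion h m fun i τ => ∑ j ∈ A, g j i τ := by
  classical
  induction A using Finset.induction_on with
  | empty => exact of_isBigO (isBigO_zero _ _)
  | insert j A hj ih =>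
    simpa only [Finset.sum_insert hj] using (hg j (A.mem_insert_self j)).add
      (ih fun l hl => hg l (Finset.mem_insert_of_mem hl))

lemma clm (L : E →L[ℝ] F) {g : ι → ℝ → E} (hg : HasUnifExpansion h m g) :
    HasUnifExpansion h m fun i τ => L (g i τ) := by
  obtain ⟨q, hq, hr⟩ := hg
  refine ⟨fun k i => L (q k i), fun k => (L.isBigO_comp _ _).trans (hq k),
    ((L.isBigO_comp _ _).trans hr).congr_left fun x => ?_⟩
  simp

lemma sub {g g' : ι → ℝ → E} (hg : HasUnifExpansion h m g) (hg' : HasUnifExpansion h m g') :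
    HasUnifExpansion h m fun i τ => g i τ - g' i τ := by
  simpa [sub_eq_add_neg] using hg.add (hg'.clm (-ContinuousLinearMap.id ℝ E))

lemma isBigO_one (hh : h =O[⊤] fun _ => (1 : ℝ)) {g : ι → ℝ → E} (hg : HasUnifExpansion h m g) :
    (fun x : ι × Icc (0 : ℝ) 1 => g x.1 x.2) =O[⊤] fun _ => (1 : ℝ) := by
  obtain ⟨q, hq, hr⟩ := hg
  have hpow : ∀ k, (fun x : ι × Icc (0 : ℝ) 1 => h x.1 ^ k) =O[⊤] fun _ => (1 : ℝ) := fun k => by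
    simpa only [pow_zero] using isBigO_comp_fst (isBigO_pow_pow hh k.zero_le)
  refine ((hr.trans (hpow m)).add (IsBigO.fun_sum fun k _ => ?_)).congr_left
    fun x => sub_add_cancel _ _
  refine (isBigO_mul_unitInterval_pow_smul (hq k) k).trans ?_
  simpa only [mul_one] using hpow k

lemma bilin (hh : h =O[⊤] fun _ => (1 : ℝ)) (B : E →L[ℝ] F →L[ℝ] G) {g : ι → ℝ → E}
    {g' : ι → ℝ → F} (hg : HasUnifExpansion h m g) (hg' : HasUnifExpansion h m g') :
    HasUnifExpansion h m fun i τ => B (g i τ) (g' i τ) := by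
  have hg'1 := hg'.isBigO_one hh
  obtain ⟨q, hq, hr⟩ := hg
  obtain ⟨q', hq', hr'⟩ := hg'
  set p : ι → ℝ → E := fun i τ => ∑ k ∈ Finset.range m, (h i * τ) ^ k • q k i
  set p' : ι → ℝ → F := fun i τ => ∑ l ∈ Finset.range m, (h i * τ) ^ l • q' l i
  have hp1 := isBigO_one hh (m := m) (g := p) (sum fun k _ => monomial hh (hq k) m k)
  have hrem : HasUnifExpansion h m fun i τ =>
      B (g i τ - p i τ) (g' i τ) + B (p i τ) (g' i τ - p' i τ) := by
    refine of_isBigO (IsBigO.add ?_ ?_)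
    · simpa only [mul_one] using isBigO_clm_apply₂ B hr hg'1
    · simpa only [one_mul] using isBigO_clm_apply₂ B hp1 hr'
  have hmain : HasUnifExpansion h m fun i τ => ∑ l ∈ Finset.range m, ∑ k ∈ Finset.range m,
      (h i * τ) ^ (l + k) • B (q k i) (q' l i) :=
    sum fun l _ => sum fun k _ => monomial hh
      (by simpa only [mul_one] using isBigO_clm_apply₂ B (hq k) (hq' l)) m (l + k)
  have hpp' : ∀ i τ, ∑ l ∈ Finset.range m, ∑ k ∈ Finset.range m,
      (h i * τ) ^ (l + k) • B (q k i) (q' l i) = B (p i τ) (p' i τ) := fun i τ => by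
    simp only [p, p', map_sum, map_smul, sum_apply, smul_apply, Finset.smul_sum, smul_smul, pow_add]
  refine (hmain.add hrem).congr fun i τ => ?_
  rw [hpp', map_sub, map_sub, sub_apply]
  abel

lemma mono (hh : h =O[⊤] fun _ => (1 : ℝ)) {g : ι → ℝ → E} (hg : HasUnifExpansion h n g)
    (hmn : m ≤ n) : HasUnifExpansion h m g := by
  obtain ⟨q, hq, hr⟩ := hg
  have hrem : HasUnifExpansion h m fun i τ =>
      g i τ - ∑ k ∈ Finset.range n, (h i * τ) ^ k • q k i :=
    of_isBigO (hr.trans (isBigO_comp_fst (isBigO_pow_pow hh hmn)))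
  simpa only [sub_add_cancel] using
    hrem.add (sum (A := Finset.range n) fun k _ => monomial hh (hq k) m k)

end HasUnifExpansion

/-- The derivative `h • g` is the one that appears when a function of physical time is rescaled to
a step of size `h`. -/
lemma isBigO_sub_sum_of_hasDerivWithinAt {q : ℕ → ι → E} {g Φ : ι → ℝ → E}
    (hr : (fun x : ι × Icc (0 : ℝ) 1 =>
      g x.1 x.2 - ∑ k ∈ Finset.range m, (h x.1 * x.2) ^ k • q k x.1) =O[⊤] fun x => h x.1 ^ m)
    (hΦ : ∀ i, ∀ τ ∈ Icc (0 : ℝ) 1, HasDerivWithinAt (Φ i) (h i • g i τ) (Icc 0 1) τ) :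
    (fun x : ι × Icc (0 : ℝ) 1 => Φ x.1 x.2 - Φ x.1 0 - ∑ k ∈ Finset.range m,
      ((h x.1 * x.2) ^ (k + 1) / (k + 1)) • q k x.1) =O[⊤] fun x => h x.1 ^ (m + 1) := by
  obtain ⟨C, hC⟩ := isBigO_top.mp hr
  refine isBigO_top.mpr ⟨C, fun ⟨i, τ⟩ => ?_⟩
  set Ψ : ℝ → E := fun τ => Φ i τ - ∑ k ∈ Finset.range m, ((h i * τ) ^ (k + 1) / (k + 1)) • q k i
    with hΨ
  have hderiv : ∀ τ ∈ Icc (0 : ℝ) 1, HasDerivWithinAt Ψ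
      (h i • (g i τ - ∑ k ∈ Finset.range m, (h i * τ) ^ k • q k i)) (Icc 0 1) τ := by
    intro τ hτ
    rw [smul_sub, Finset.smul_sum]
    refine (hΦ i τ hτ).sub (HasDerivWithinAt.fun_sum fun k _ => ?_)
    have hpow := (((hasDerivAt_id τ).const_mul (h i)).pow (k + 1)).div_const (k + 1 : ℝ)
    refine ((hpow.smul_const (q k i)).congr_deriv ?_).hasDerivWithinAt
    rw [smul_smul]
    congr 1
    push_cast
    simp only [id]
    field_simp
  have hmean := norm_image_sub_le_of_norm_deriv_le_segment' hderiv
    (C := C * ‖h i ^ (m + 1)‖) (fun τ hτ => ?_) τ τ.2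
  · have h0 : Φ i τ - Φ i 0 - ∑ k ∈ Finset.range m, ((h i * τ) ^ (k + 1) / (k + 1)) • q k i =
        Ψ τ - Ψ 0 := by
      simp [hΨ]
      abel
    have hnonneg : 0 ≤ C * ‖h i ^ (m + 1)‖ := by
      rw [pow_succ, norm_mul, ← mul_assoc]
      exact mul_nonneg ((norm_nonneg _).trans (hC (i, τ))) (norm_nonneg _)
    rw [h0]
    refine hmean.trans ?_
    rw [sub_zero]
    exact mul_le_of_le_one_right hnonneg τ.2.2
  · rw [norm_smul, pow_succ, norm_mul, mul_comm, ← mul_assoc]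
    exact mul_le_mul_of_nonneg_right (hC (i, ⟨τ, Ico_subset_Icc_self hτ⟩)) (norm_nonneg _)

namespace HasUnifExpansion

lemma of_hasDerivWithinAt (hh : h =O[⊤] fun _ => (1 : ℝ)) {g Φ : ι → ℝ → E}
    (hg : HasUnifExpansion h m g) (h0 : (fun i => Φ i 0) =O[⊤] fun _ => (1 : ℝ))
    (hΦ : ∀ i, ∀ τ ∈ Icc (0 : ℝ) 1, HasDerivWithinAt (Φ i) (h i • g i τ) (Icc 0 1) τ) :
    HasUnifExpansion h (m + 1) Φ := by
  obtain ⟨q, hq, hr⟩ := hg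
  have hrem : HasUnifExpansion h (m + 1) fun i τ => Φ i τ - Φ i 0 -
      ∑ k ∈ Finset.range m, ((h i * τ) ^ (k + 1) / (k + 1)) • q k i :=
    of_isBigO (isBigO_sub_sum_of_hasDerivWithinAt hr hΦ)
  have hsum : HasUnifExpansion h (m + 1) fun i τ =>
      ∑ k ∈ Finset.range m, (h i * τ) ^ (k + 1) • ((k + 1 : ℝ)⁻¹ • q k i) :=
    sum fun k _ => monomial hh ((hq k).const_smul_left _) _ _
  refine (hrem.add (hsum.add (const hh h0 _))).congr fun i τ => ?_
  simp only [smul_smul, div_eq_mul_inv]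
  abel

/-- The nodes and weights of a quadrature formula enter only through the monomials it integrates
exactly. -/
lemma isBigO_quadrature {J : Type*} [Fintype J] {A x : J → ℝ} {t : ℝ} {g Φ : ι → ℝ → E}
    (hg : HasUnifExpansion h m g) (hx : ∀ j, x j ∈ Icc (0 : ℝ) 1) (ht : t ∈ Icc (0 : ℝ) 1)
    (hA : ∀ k < m, ∑ j, A j * x j ^ k = t ^ (k + 1) / (k + 1))
    (hΦ : ∀ i, ∀ τ ∈ Icc (0 : ℝ) 1, HasDerivWithinAt (Φ i) (h i • g i τ) (Icc 0 1) τ) :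
    (fun i => Φ i t - Φ i 0 - h i • ∑ j, A j • g i (x j)) =O[⊤] fun i => h i ^ (m + 1) := by
  obtain ⟨q, -, hr⟩ := hg
  have hint := isBigO_comp_prodMk (isBigO_sub_sum_of_hasDerivWithinAt hr hΦ) ⟨t, ht⟩
  have hnodes : (fun i => h i • ∑ j, A j • (g i (x j) -
      ∑ k ∈ Finset.range m, (h i * x j) ^ k • q k i)) =O[⊤] fun i => h i * h i ^ m :=
    (isBigO_refl h ⊤).smul (IsBigO.fun_sum fun j _ =>
      (isBigO_comp_prodMk hr ⟨x j, hx j⟩).const_smul_left (A j))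
  have hexact : ∀ i, h i • ∑ j, A j • ∑ k ∈ Finset.range m, (h i * x j) ^ k • q k i =
      ∑ k ∈ Finset.range m, ((h i * t) ^ (k + 1) / (k + 1)) • q k i := by
    intro i
    simp only [Finset.smul_sum, smul_smul]
    rw [Finset.sum_comm]
    refine Finset.sum_congr rfl fun k hk => ?_
    rw [← Finset.sum_smul, mul_pow, mul_div_assoc, ← hA k (Finset.mem_range.mp hk), Finset.mul_sum]
    congr 1
    exact Finset.sum_congr rfl fun j _ => by ring
  refine (hint.sub (hnodes.congr_right fun i => (pow_succ' _ _).symm)).congr_left fun i => ?_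
  simp only [smul_sub, Finset.sum_sub_distrib, hexact]
  abel

lemma isBigO_extrapolation {J : Type*} [Fintype J] {w x : J → ℝ} {c : ℝ} {g : ι → ℝ → E}
    (hg : HasUnifExpansion h m g) (hx : ∀ j, x j ∈ Icc (0 : ℝ) 1)
    (hw : ∀ k < m, c * 0 ^ k + ∑ j, w j * x j ^ k = 1) :
    (fun i => c • g i 0 + ∑ j, w j • g i (x j) - g i 1) =O[⊤] fun i => h i ^ m := by
  obtain ⟨q, -, hr⟩ := hg
  have hat : ∀ t ∈ Icc (0 : ℝ) 1, (fun i => g i t -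
      ∑ k ∈ Finset.range m, (h i * t) ^ k • q k i) =O[⊤] fun i => h i ^ m := fun t ht =>
    isBigO_comp_prodMk hr ⟨t, ht⟩
  have hsum := (((hat 0 (by simp)).const_smul_left c).add
    (IsBigO.fun_sum fun j (_ : j ∈ Finset.univ) =>
      (hat (x j) (hx j)).const_smul_left (w j))).sub (hat 1 (by simp))
  refine hsum.congr_left fun i => ?_
  have hexact : c • ∑ k ∈ Finset.range m, (h i * 0) ^ k • q k i +
      ∑ j, w j • ∑ k ∈ Finset.range m, (h i * x j) ^ k • q k i =
      ∑ k ∈ Finset.range m, (h i * 1) ^ k • q k i := by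
    simp only [Finset.smul_sum, smul_smul]
    rw [Finset.sum_comm, ← Finset.sum_add_distrib]
    refine Finset.sum_congr rfl fun k hk => ?_
    rw [← Finset.sum_smul, ← add_smul, mul_one, ← mul_one (h i ^ k),
      ← hw k (Finset.mem_range.mp hk), mul_add, Finset.mul_sum]
    congr 2
    · rw [mul_pow, mul_left_comm]
    · exact Finset.sum_congr rfl fun j _ => by ring
  simp only [Pi.smul_apply, smul_sub, Finset.sum_sub_distrib, ← hexact]
  abel

lemma eval_smul (hh : h =O[⊤] fun _ => (1 : ℝ)) (h0 : ∀ i, h i ≠ 0) {p : ℝ[X]}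
    (hp : p.natDegree ≤ n) {c : ι → E} (hc : c =O[⊤] fun i => h i ^ n) (m : ℕ) :
    HasUnifExpansion h m fun i τ => p.eval τ • c i := by
  have hcoeff : ∀ l ≤ n, (fun i => p.coeff l • (h i ^ l)⁻¹ • c i) =O[⊤] fun _ => (1 : ℝ) := by
    intro l hl
    refine ((isBigO_refl (fun i => (h i ^ l)⁻¹) ⊤).smul
      (hc.trans (isBigO_pow_pow hh hl))).const_smul_left _ |>.congr_right fun i => ?_
    exact inv_mul_cancel₀ (pow_ne_zero l (h0 i))
  refine (sum fun l hl => monomial hh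
    (hcoeff l (Nat.lt_succ_iff.mp (Finset.mem_range.mp hl))) m l).congr fun i τ => ?_
  rw [Polynomial.eval_eq_sum_range' (Nat.lt_succ_of_le hp), Finset.sum_smul]
  refine Finset.sum_congr rfl fun l _ => ?_
  rw [smul_smul, smul_smul, mul_pow]
  congr 1
  have := pow_ne_zero l (h0 i)
  field_simp

lemma interpolate (hh : h =O[⊤] fun _ => (1 : ℝ)) (h0 : ∀ i, h i ≠ 0) {s : ℕ} {γ : Fin s → ℝ}
    (hγ : Function.Injective γ) (hγmem : ∀ j, γ j ∈ Icc (0 : ℝ) 1) {g : ι → ℝ → E}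
    (hg : HasUnifExpansion h m g) :
    HasUnifExpansion h m fun i τ => ∑ j, (Lagrange.basis Finset.univ γ j).eval τ • g i (γ j) := by
  obtain ⟨q, hq, hr⟩ := hg
  have hrem : HasUnifExpansion h m fun i τ => ∑ j, (Lagrange.basis Finset.univ γ j).eval τ •
      (g i (γ j) - ∑ k ∈ Finset.range m, (h i * γ j) ^ k • q k i) :=
    of_isBigO (IsBigO.fun_sum fun j _ => by
      simpa only [one_smul, smul_eq_mul, one_mul] using
        (isBigO_eval_unitInterval (Lagrange.basis Finset.univ γ j)).smul
          (isBigO_comp_fst (isBigO_comp_prodMk hr ⟨γ j, hγmem j⟩)))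
  have hmain : HasUnifExpansion h m fun i τ => ∑ k ∈ Finset.range m,
      (∑ j, Polynomial.C (γ j ^ k) * Lagrange.basis Finset.univ γ j).eval τ • h i ^ k • q k i :=
    sum fun k _ => eval_smul hh h0 (natDegree_sum_pow_mul_basis_le hγ k)
      (by simpa using (isBigO_refl (fun i => h i ^ k) ⊤).smul (hq k)) m
  refine (hrem.add hmain).congr fun i τ => ?_
  simp only [smul_sub, Finset.sum_sub_distrib, Polynomial.eval_finsetSum, Polynomial.eval_mul,
    Polynomial.eval_C, Finset.smul_sum, smul_smul, mul_pow]
  rw [Finset.sum_comm, sub_add, sub_eq_self, sub_eq_zero]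
  refine Finset.sum_congr rfl fun k _ => ?_
  rw [Finset.sum_mul, Finset.sum_smul]
  refine Finset.sum_congr rfl fun j _ => ?_
  congr 1
  ring

end HasUnifExpansion

end Expansion

section Rescaled

variable {ι E : Type*} [NormedAddCommGroup E] [NormedSpace ℝ E] {h : ι → ℝ} {m : ℕ}

lemma isBigO_sub_of_hasDerivWithinAt {g Φ : ι → ℝ → E} (b : Icc (0 : ℝ) 1)
    (hg : (fun x : ι × Icc (0 : ℝ) 1 => g x.1 x.2) =O[⊤] fun x => h x.1 ^ m)
    (hΦ : ∀ i, ∀ τ ∈ Icc (0 : ℝ) 1, HasDerivWithinAt (Φ i) (h i • g i τ) (Icc 0 1) τ) :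
    (fun x : ι × Icc (0 : ℝ) 1 => Φ x.1 x.2 - Φ x.1 b) =O[⊤] fun x => h x.1 ^ (m + 1) := by
  have h0 : (fun x : ι × Icc (0 : ℝ) 1 => Φ x.1 x.2 - Φ x.1 0) =O[⊤] fun x => h x.1 ^ (m + 1) := by
    simpa using isBigO_sub_sum_of_hasDerivWithinAt (q := 0) (by simpa using hg) hΦ
  refine (h0.sub (isBigO_comp_fst (isBigO_comp_prodMk h0 b))).congr_left fun x => ?_
  exact sub_sub_sub_cancel_right _ _ _

end Rescaled

section Solution

variable {V : Type*} [NormedAddCommGroup V] [NormedSpace ℝ V]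

/-- `y` solves the autonomous differential equation `y' = f(y)` on `[0, T]`. -/
def SolvesODE (f : V → V) (T : ℝ) (y : ℝ → V) : Prop :=
  ∀ t ∈ Icc 0 T, HasDerivWithinAt y (f (y t)) (Icc 0 T) t

section LieDeriv

variable {E : Type*} [NormedAddCommGroup E] [NormedSpace ℝ E]

/-- The derivative of the observable `φ` along solutions of `y' = f(y)`. -/
def lieDeriv (f : V → V) (φ : V → E) (x : V) : E := fderiv ℝ φ x (f x)

lemma contDiff_lieDeriv {f : V → V} (hf : ContDiff ℝ ∞ f) {φ : V → E} (hφ : ContDiff ℝ ∞ φ) :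
    ContDiff ℝ ∞ (lieDeriv f φ) :=
  (hφ.fderiv_right (by simp)).clm_apply hf

lemma lieDeriv_id (f : V → V) : lieDeriv f id = f := by
  funext x
  simp [lieDeriv]

end LieDeriv

namespace SolvesODE

variable {f : V → V} {T : ℝ} {y : ℝ → V}

lemma continuousOn (hy : SolvesODE f T y) : ContinuousOn y (Icc 0 T) :=
  fun t ht => (hy t ht).continuousWithinAt

lemma exists_norm_comp_le {E : Type*} [SeminormedAddCommGroup E] (hy : SolvesODE f T y) {φ : V → E}
    (hφ : Continuous φ) : ∃ C, ∀ t ∈ Icc 0 T, ‖φ (y t)‖ ≤ C :=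
  isCompact_Icc.exists_bound_of_continuousOn (hφ.comp_continuousOn hy.continuousOn)

variable {E : Type*} [NormedAddCommGroup E] [NormedSpace ℝ E]

lemma hasDerivWithinAt_comp (hy : SolvesODE f T y) {φ : V → E} (hφ : ContDiff ℝ ∞ φ)
    {t : ℝ} (ht : t ∈ Icc 0 T) :
    HasDerivWithinAt (fun t => φ (y t)) (lieDeriv f φ (y t)) (Icc 0 T) t :=
  ((hφ.differentiable (by simp)) (y t)).hasFDerivAt.comp_hasDerivWithinAt t (hy t ht)

lemma hasDerivWithinAt_rescaled (hy : SolvesODE f T y) {φ : V → E} (hφ : ContDiff ℝ ∞ φ)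
    {S : Set ℝ} {a h τ : ℝ} (hS : ∀ σ ∈ S, a + h * σ ∈ Icc 0 T) (hτ : τ ∈ S) :
    HasDerivWithinAt (fun τ => φ (y (a + h * τ))) (h • lieDeriv f φ (y (a + h * τ))) S τ := by
  have haffine : HasDerivWithinAt (fun τ : ℝ => a + h * τ) h S τ := by
    simpa using (((hasDerivAt_id τ).const_mul h).const_add a).hasDerivWithinAt
  exact (hy.hasDerivWithinAt_comp hφ (hS τ hτ)).scomp τ haffine hS

lemma hasDerivWithinAt_diffQuot (hy : SolvesODE f T y) {φ : V → E} (hφ : ContDiff ℝ ∞ φ)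
    {S : Set ℝ} {a h τ : ℝ} (hS : ∀ σ ∈ S, a + h * σ ∈ Icc 0 T)
    (hS' : ∀ σ ∈ S, a + h + h * σ ∈ Icc 0 T) (hτ : τ ∈ S) :
    HasDerivWithinAt (fun τ => h⁻¹ • (φ (y (a + h + h * τ)) - φ (y (a + h * τ))))
      (h • h⁻¹ • (lieDeriv f φ (y (a + h + h * τ)) - lieDeriv f φ (y (a + h * τ)))) S τ := by
  rw [smul_comm, smul_sub]
  exact ((hy.hasDerivWithinAt_rescaled hφ hS' hτ).sub
    (hy.hasDerivWithinAt_rescaled hφ hS hτ)).const_smul h⁻¹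

lemma exists_norm_comp_sub_le (hy : SolvesODE f T y) (hf : Continuous f) {φ : V → E}
    (hφ : ContDiff ℝ ∞ φ) :
    ∃ C, ∀ t ∈ Icc 0 T, ∀ t' ∈ Icc 0 T, ‖φ (y t') - φ (y t)‖ ≤ C * |t' - t| := by
  obtain ⟨C, hC⟩ := hy.exists_norm_comp_le
    (φ := lieDeriv f φ) ((hφ.continuous_fderiv (by simp)).clm_apply hf)
  exact ⟨C, fun t ht t' ht' => (convex_Icc 0 T).norm_image_sub_le_of_norm_hasDerivWithin_le
    (fun t ht => hy.hasDerivWithinAt_comp hφ ht) hC ht ht'⟩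

variable {ι : Type*} {a h : ι → ℝ} {φ : V → E}

lemma hasUnifExpansion (hy : SolvesODE f T y) (hf : ContDiff ℝ ∞ f)
    (hh : h =O[⊤] fun _ => (1 : ℝ)) (hmem : ∀ i, ∀ τ ∈ Icc (0 : ℝ) 1, a i + h i * τ ∈ Icc 0 T)
    (hφ : ContDiff ℝ ∞ φ) (m : ℕ) : HasUnifExpansion h m fun i τ => φ (y (a i + h i * τ)) := by
  obtain ⟨C, hC⟩ := hy.exists_norm_comp_le hφ.continuous
  induction m generalizing φ C with
  | zero =>
    exact .of_isBigO (isBigO_top.mpr ⟨C, fun x => by simpa using hC _ (hmem x.1 x.2 x.2.2)⟩)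
  | succ m ih =>
    obtain ⟨C', hC'⟩ := hy.exists_norm_comp_le (contDiff_lieDeriv hf hφ).continuous
    refine .of_hasDerivWithinAt hh (ih (contDiff_lieDeriv hf hφ) C' hC') ?_
      fun i τ hτ => hy.hasDerivWithinAt_rescaled hφ (hmem i) hτ
    exact isBigO_top.mpr ⟨C, fun i => by simpa using hC _ (hmem i 0 (by simp))⟩

/-- The change of a smooth observable from one step to the next is `h` times a function that again
has an expansion. -/
lemma hasUnifExpansion_diffQuot (hy : SolvesODE f T y) (hf : ContDiff ℝ ∞ f)
    (hh : h =O[⊤] fun _ => (1 : ℝ)) (hmem : ∀ i, ∀ τ ∈ Icc (0 : ℝ) 1, a i + h i * τ ∈ Icc 0 T)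
    (hmem' : ∀ i, ∀ τ ∈ Icc (0 : ℝ) 1, a i + h i + h i * τ ∈ Icc 0 T)
    (hφ : ContDiff ℝ ∞ φ) (m : ℕ) :
    HasUnifExpansion h m fun i τ =>
      (h i)⁻¹ • (φ (y (a i + h i + h i * τ)) - φ (y (a i + h i * τ))) := by
  have hbound : ∀ {φ : V → E}, ContDiff ℝ ∞ φ → ∃ C, ∀ i, ∀ τ ∈ Icc (0 : ℝ) 1,
      ‖(h i)⁻¹ • (φ (y (a i + h i + h i * τ)) - φ (y (a i + h i * τ)))‖ ≤ C := fun {φ} hφ => by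
    obtain ⟨C, hC⟩ := hy.exists_norm_comp_sub_le hf.continuous hφ
    refine ⟨max C 0, fun i τ hτ => ?_⟩
    have hdiff := hC _ (hmem i τ hτ) _ (hmem' i τ hτ)
    rw [add_right_comm, add_sub_cancel_left] at hdiff
    rw [norm_smul, norm_inv, Real.norm_eq_abs, add_right_comm]
    rcases eq_or_ne (h i) 0 with h0 | h0
    · simp [h0]
    · rw [inv_mul_le_iff₀ (abs_pos.mpr h0), mul_comm |h i|]
      exact hdiff.trans (mul_le_mul_of_nonneg_right (le_max_left _ _) (abs_nonneg _))
  induction m generalizing φ with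
  | zero =>
    obtain ⟨C, hC⟩ := hbound hφ
    exact .of_isBigO (isBigO_top.mpr ⟨C, fun x => by simpa using hC x.1 x.2 x.2.2⟩)
  | succ m ih =>
    obtain ⟨C, hC⟩ := hbound hφ
    refine .of_hasDerivWithinAt hh (ih (contDiff_lieDeriv hf hφ)) ?_
      fun i τ hτ => hy.hasDerivWithinAt_diffQuot hφ (hmem i) (hmem' i) hτ
    exact isBigO_top.mpr ⟨C, fun i => by simpa using hC i 0 (by simp)⟩

end SolvesODE

end Solution

section Picard

variable {V : Type*} [NormedAddCommGroup V] [NormedSpace ℝ V]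

/-- Picard iterates for the adjoint variational equation `W' = -h W A`, `W(1) = 1` on `[0, 1]`;
`A` is extended by constants to the real line. -/
def picard (h : ℝ) (A : ℝ → V →L[ℝ] V) : ℕ → ℝ → V →L[ℝ] V
  | 0 => fun _ => 1
  | m + 1 => fun τ => 1 - ∫ σ in (1 : ℝ)..τ,
      h • (picard h A m σ).comp (IccExtend zero_le_one ((Icc (0 : ℝ) 1).domRestrict A) σ)

lemma picard_one (h : ℝ) (A : ℝ → V →L[ℝ] V) (m : ℕ) : picard h A m 1 = 1 := by
  cases m <;> simp [picard]

lemma continuous_picard {A : ℝ → V →L[ℝ] V} (hA : ContinuousOn A (Icc 0 1)) (h : ℝ) (m : ℕ) :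
    Continuous (picard h A m) := by
  induction m with
  | zero => exact continuous_const
  | succ m ih =>
    refine continuous_const.sub (intervalIntegral.continuous_primitive (fun a b => ?_) _)
    exact ((ih.clm_comp hA.domRestrict.Icc_extend').const_smul h).intervalIntegrable a b

variable [CompleteSpace V]

lemma hasDerivWithinAt_picard_succ {A : ℝ → V →L[ℝ] V} (hA : ContinuousOn A (Icc 0 1)) (h : ℝ)
    (m : ℕ) {τ : ℝ} (hτ : τ ∈ Icc (0 : ℝ) 1) :
    HasDerivWithinAt (picard h A (m + 1)) (h • -(picard h A m τ).comp (A τ)) (Icc 0 1) τ := by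
  have hc : Continuous fun σ => h • (picard h A m σ).comp
      (IccExtend zero_le_one ((Icc (0 : ℝ) 1).domRestrict A) σ) :=
    ((continuous_picard hA h m).clm_comp hA.domRestrict.Icc_extend').const_smul h
  have hderiv := (hc.integral_hasStrictDerivAt 1 τ).hasDerivAt.const_sub 1
  rw [IccExtend_of_mem _ _ hτ, ← smul_neg] at hderiv
  exact hderiv.hasDerivWithinAt

variable {ι : Type*} {h : ι → ℝ} {A : ι → ℝ → V →L[ℝ] V}

lemma hasUnifExpansion_picard (hh : h =O[⊤] fun _ => (1 : ℝ))
    (hA : ∀ i, ContinuousOn (A i) (Icc 0 1)) (hexp : ∀ n, HasUnifExpansion h n A) (m n : ℕ) :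
    HasUnifExpansion h n fun i => picard (h i) (A i) m := by
  induction m generalizing n with
  | zero => exact .const hh (isBigO_const_const _ one_ne_zero _) n
  | succ m ih =>
    let g : ι → ℝ → V →L[ℝ] V := fun i τ => -(picard (h i) (A i) m τ).comp (A i τ)
    have hg : ∀ n, HasUnifExpansion h n g := fun n =>
      .bilin hh (-ContinuousLinearMap.compL ℝ V V V) (ih n) (hexp n)
    have hΦ : ∀ i, ∀ τ ∈ Icc (0 : ℝ) 1, HasDerivWithinAt (picard (h i) (A i) (m + 1))
        (h i • g i τ) (Icc 0 1) τ := fun i τ => hasDerivWithinAt_picard_succ (hA i) (h i) m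
    have hg1 : (fun x : ι × Icc (0 : ℝ) 1 => g x.1 x.2) =O[⊤] fun x => h x.1 ^ 0 := by
      simpa only [pow_zero] using (hg 0).isBigO_one hh
    have hvar := isBigO_comp_prodMk
      (isBigO_sub_of_hasDerivWithinAt ⟨1, by simp⟩ hg1 hΦ) ⟨0, by simp⟩
    refine (HasUnifExpansion.of_hasDerivWithinAt hh (hg n) ?_ hΦ).mono hh n.le_succ
    refine ((hvar.trans (by simpa using hh)).add
      (isBigO_const_const (1 : V →L[ℝ] V) one_ne_zero ⊤)).congr_left fun i => ?_
    simp [picard_one]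

lemma isBigO_picard_succ_sub (hh : h =O[⊤] fun _ => (1 : ℝ))
    (hA : ∀ i, ContinuousOn (A i) (Icc 0 1)) (hexp : ∀ n, HasUnifExpansion h n A) (m : ℕ) :
    (fun x : ι × Icc (0 : ℝ) 1 => picard (h x.1) (A x.1) (m + 1) x.2 -
      picard (h x.1) (A x.1) m x.2) =O[⊤] fun x => h x.1 ^ (m + 1) := by
  have hbase : ∀ m, (fun x : ι × Icc (0 : ℝ) 1 =>
      -(picard (h x.1) (A x.1) m x.2).comp (A x.1 x.2)) =O[⊤] fun _ => (1 : ℝ) := fun m => by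
    simpa using isBigO_clm_apply₂ (-ContinuousLinearMap.compL ℝ V V V)
      ((hasUnifExpansion_picard hh hA hexp m 0).isBigO_one hh) ((hexp 0).isBigO_one hh)
  induction m with
  | zero =>
    refine (isBigO_sub_of_hasDerivWithinAt ⟨1, by simp⟩ (m := 0) (by simpa using hbase 0)
      fun i τ => hasDerivWithinAt_picard_succ (hA i) (h i) 0).congr_left fun x => ?_
    simp [picard]
  | succ m ih =>
    have hg := isBigO_clm_apply₂ (-ContinuousLinearMap.compL ℝ V V V) ih
      ((hexp 0).isBigO_one hh)
    refine (isBigO_sub_of_hasDerivWithinAt ⟨1, by simp⟩ (m := m + 1) (by simpa using hg)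
      fun i τ hτ => ((hasDerivWithinAt_picard_succ (hA i) (h i) (m + 1) hτ).sub
        (hasDerivWithinAt_picard_succ (hA i) (h i) m hτ)).congr_deriv ?_).congr_left fun x => ?_
    · rw [← smul_sub]
      congr 1
      simp [neg_add_eq_sub]
    · simp [picard_one]

lemma isBigO_picard_sub_one (hh : h =O[⊤] fun _ => (1 : ℝ))
    (hA : ∀ i, ContinuousOn (A i) (Icc 0 1)) (hexp : ∀ n, HasUnifExpansion h n A) (m : ℕ) :
    (fun x : ι × Icc (0 : ℝ) 1 => picard (h x.1) (A x.1) m x.2 - 1) =O[⊤] fun x => h x.1 := by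
  induction m with
  | zero =>
    simp only [picard, sub_self]
    exact isBigO_zero _ _
  | succ m ih =>
    have hpow := isBigO_comp_fst (β := Icc (0 : ℝ) 1) (isBigO_pow_pow hh (Nat.le_add_left 1 m))
    simp only [pow_one] at hpow
    refine (((isBigO_picard_succ_sub hh hA hexp m).trans hpow).add ih).congr_left fun x => ?_
    exact sub_add_sub_cancel _ _ _

end Picard

section Ball

variable {ι V E : Type*} [NormedAddCommGroup V] [NormedSpace ℝ V] [ProperSpace V]
  [NormedAddCommGroup E] [NormedSpace ℝ E] {φ : V → E} {ρ : ℝ} {u v : ι → V}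

lemma isBigO_comp_sub_comp (hφ : ContDiff ℝ ∞ φ) (hu : ∀ i, ‖u i‖ ≤ ρ) (hv : ∀ i, ‖v i‖ ≤ ρ) :
    (fun i => φ (u i) - φ (v i)) =O[⊤] fun i => u i - v i := by
  obtain ⟨L, hL⟩ := (isCompact_closedBall (0 : V) ρ).exists_bound_of_continuousOn
    (hφ.continuous_fderiv (by simp)).continuousOn
  refine isBigO_top.mpr ⟨L, fun i => ?_⟩
  exact (convex_closedBall (0 : V) ρ).norm_image_sub_le_of_norm_fderiv_le
    (fun z _ => hφ.differentiable (by simp) z) hL (by simpa using hv i) (by simpa using hu i)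

lemma isBigO_comp_sub_comp_sub_fderiv (hφ : ContDiff ℝ ∞ φ) (hu : ∀ i, ‖u i‖ ≤ ρ)
    (hv : ∀ i, ‖v i‖ ≤ ρ) :
    (fun i => φ (u i) - φ (v i) - fderiv ℝ φ (v i) (u i - v i)) =O[⊤]
      fun i => ‖u i - v i‖ ^ 2 := by
  let pts : ι × Metric.closedBall (0 : V) ρ → V := fun x => x.2
  obtain ⟨L, hL⟩ := isBigO_top.mp (isBigO_comp_sub_comp (ρ := ρ) (u := pts) (v := fun x => v x.1)
    (hφ.fderiv_right (m := ∞) (by simp)) (fun x => mem_closedBall_zero_iff.mp x.2.2)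
    fun x => hv x.1)
  refine isBigO_top.mpr ⟨max L 0, fun i => ?_⟩
  have hseg : segment ℝ (v i) (u i) ⊆ Metric.closedBall (0 : V) ρ :=
    (convex_closedBall (0 : V) ρ).segment_subset (by simpa using hv i) (by simpa using hu i)
  have hmean := (convex_segment (𝕜 := ℝ) (v i) (u i)).norm_image_sub_le_of_norm_fderiv_le'
    (𝕜 := ℝ) (f := φ) (φ := fderiv ℝ φ (v i)) (C := max L 0 * ‖u i - v i‖)
    (fun z _ => hφ.differentiable (by simp) z) (fun z hz => ?_)
    (left_mem_segment ℝ (v i) (u i)) (right_mem_segment ℝ (v i) (u i))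
  · rwa [norm_pow, norm_norm, sq, ← mul_assoc]
  · exact (hL (i, ⟨z, hseg hz⟩)).trans (mul_le_mul (le_max_left _ _)
      (norm_sub_le_of_mem_segment hz) (norm_nonneg _) (le_max_right _ _))

end Ball

lemma isBigO_left_add {ι : Type*} {a b : ι → ℝ} (ha : ∀ i, 0 ≤ a i) (hb : ∀ i, 0 ≤ b i) :
    a =O[⊤] fun i => a i + b i :=
  isBigO_of_le _ fun i => abs_le_abs_of_nonneg (ha i) (le_add_of_nonneg_right (hb i))

lemma isBigO_right_add {ι : Type*} {a b : ι → ℝ} (ha : ∀ i, 0 ≤ a i) (hb : ∀ i, 0 ≤ b i) :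
    b =O[⊤] fun i => a i + b i :=
  isBigO_of_le _ fun i => abs_le_abs_of_nonneg (hb i) (le_add_of_nonneg_left (ha i))

section CollStep

variable {s : ℕ} {V : Type*} [NormedAddCommGroup V] [NormedSpace ℝ V]

/-- `Y` are the stages of a step of size `h` of the collocation method for `y' = f(y)` from `v`. -/
def IsStages (γ : Fin s → ℝ) (f : V → V) (h : ℝ) (v : V) (Y : Fin s → V) : Prop :=
  ∀ i, Y i = v + h • ∑ j, collA γ i j • f (Y j)

/-- The result of the step of size `h` from `v` with the stages `Y`. -/
def collNext (γ : Fin s → ℝ) (f : V → V) (h : ℝ) (v : V) (Y : Fin s → V) : V :=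
  v + h • ∑ j, collB γ j • f (Y j)

/-- A step of the collocation method for `y' = f(y)` near the solution `y` on `[0, T]`: it has size
`h`, starts at time `a` from the value `v`, and its stages `Y` are bounded by `ρ`. The bounds in the
estimates below are uniform over all such steps. -/
structure CollStep (γ : Fin s → ℝ) (f : V → V) (y : ℝ → V) (T ρ : ℝ) where
  (h a : ℝ)
  v : V
  Y : Fin s → V
  h_mem : h ∈ Ioc (0 : ℝ) 1
  a_nonneg : 0 ≤ a
  le_T : a + h ≤ T
  norm_sub_le : ‖v - y a‖ ≤ h ^ s
  norm_Y_le : ∀ i, ‖Y i‖ ≤ ρ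
  isStages : IsStages γ f h v Y

namespace CollStep

variable {γ : Fin s → ℝ} {f : V → V} {y : ℝ → V} {T ρ : ℝ}

/-- The error with which the step starts. -/
def initError (c : CollStep γ f y T ρ) : V := c.v - y c.a

/-- The errors of the stages. -/
def stageError (c : CollStep γ f y T ρ) (j : Fin s) : V := c.Y j - y (c.a + c.h * γ j)

/-- The errors of the slopes `f (Y j)` at the stages. -/
def slopeError (c : CollStep γ f y T ρ) (j : Fin s) : V :=
  f (c.Y j) - f (y (c.a + c.h * γ j))

/-- The error at the end of the step. -/
def nextError (c : CollStep γ f y T ρ) : V := collNext γ f c.h c.v c.Y - y (c.a + c.h)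

/-- What is missing for the exact solution to satisfy the stage equation `j`. -/
def stageDefect (c : CollStep γ f y T ρ) (j : Fin s) : V :=
  y (c.a + c.h * γ j) - y c.a - c.h • ∑ l, collA γ j l • f (y (c.a + c.h * γ l))

lemma stageError_eq (c : CollStep γ f y T ρ) (j : Fin s) :
    c.stageError j = c.initError + c.h • ∑ l, collA γ j l • c.slopeError l - c.stageDefect j := by
  simp only [stageError, initError, slopeError, stageDefect, smul_sub, Finset.sum_sub_distrib]
  conv_lhs => rw [c.isStages j]
  abel

lemma time_mem (c : CollStep γ f y T ρ) {τ : ℝ} (hτ : τ ∈ Icc (0 : ℝ) 1) :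
    c.a + c.h * τ ∈ Icc 0 T :=
  ⟨add_nonneg c.a_nonneg (mul_nonneg c.h_mem.1.le hτ.1),
    (add_le_add_right (mul_le_of_le_one_right c.h_mem.1.le hτ.2) _).trans c.le_T⟩

variable {ι : Type*}

lemma isBigO_h (c : ι → CollStep γ f y T ρ) : (fun i => (c i).h) =O[⊤] fun _ => (1 : ℝ) :=
  isBigO_of_le _ fun i => by simpa [abs_of_pos (c i).h_mem.1] using (c i).h_mem.2

lemma isBigO_initError (c : ι → CollStep γ f y T ρ) :
    (fun i => (c i).initError) =O[⊤] fun i => (c i).h ^ s :=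
  isBigO_of_le _ fun i => (c i).norm_sub_le.trans (le_abs_self _)

lemma isBigO_stageDefect (hy : SolvesODE f T y) (hf : ContDiff ℝ ∞ f) (hγ : IsGaussNodes γ)
    (c : ι → CollStep γ f y T ρ) (j : Fin s) :
    (fun i => (c i).stageDefect j) =O[⊤] fun i => (c i).h ^ (s + 1) := by
  have hnode : ∀ j, γ j ∈ Icc (0 : ℝ) 1 := fun j => Ioo_subset_Icc_self (hγ.mem_Ioo j)
  have hquad := HasUnifExpansion.isBigO_quadrature (A := collA γ j) (t := γ j)
    (Φ := fun i τ => y ((c i).a + (c i).h * τ))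
    (hy.hasUnifExpansion hf (isBigO_h c) (fun i _ => (c i).time_mem) hf s) hnode (hnode j)
    (fun k hk => by simpa only [collA_eq] using sum_collPoly_mul_pow hγ.1 hk (γ j))
    (fun i τ hτ => by
      simpa only [lieDeriv_id, id] using
        hy.hasDerivWithinAt_rescaled contDiff_id (fun _ => (c i).time_mem) hτ)
  exact hquad.congr_left fun i => by simp only [stageDefect, mul_zero, add_zero]

section Proper

variable [ProperSpace V]

lemma isBigO_slopeError (hf : ContDiff ℝ ∞ f) (hγ : IsGaussNodes γ)
    (hρ : ∀ t ∈ Icc 0 T, ‖y t‖ ≤ ρ) (c : ι → CollStep γ f y T ρ) (j : Fin s) :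
    (fun i => (c i).slopeError j) =O[⊤] fun i => (c i).stageError j :=
  isBigO_comp_sub_comp hf (fun i => (c i).norm_Y_le j)
    fun i => hρ _ ((c i).time_mem (Ioo_subset_Icc_self (hγ.mem_Ioo j)))

/-- The stage equations turn a bound `u + h ^ k` on the stage errors into `u + h ^ (k + 1)`. -/
lemma isBigO_stageError (hy : SolvesODE f T y) (hf : ContDiff ℝ ∞ f) (hγ : IsGaussNodes γ)
    (hρ : ∀ t ∈ Icc 0 T, ‖y t‖ ≤ ρ) (c : ι → CollStep γ f y T ρ) (j : Fin s) :
    (fun i => (c i).stageError j) =O[⊤] fun i => ‖(c i).initError‖ + (c i).h ^ (s + 1) := by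
  have hbootstrap : ∀ k ≤ s + 1, ∀ j, (fun i => (c i).stageError j) =O[⊤]
      fun i => ‖(c i).initError‖ + (c i).h ^ k := by
    intro k hk
    induction k with
    | zero =>
      refine fun j => isBigO_top.mpr ⟨ρ + ρ, fun i => ?_⟩
      have hle : ‖(c i).stageError j‖ ≤ ρ + ρ := norm_sub_le_of_le ((c i).norm_Y_le j)
        (hρ _ ((c i).time_mem (Ioo_subset_Icc_self (hγ.mem_Ioo j))))
      refine hle.trans (le_mul_of_one_le_right ((norm_nonneg _).trans hle) ?_)
      simpa using (le_add_of_nonneg_left (norm_nonneg (c i).initError)).trans (le_abs_self _)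
    | succ k ih =>
      intro j
      have hnonneg : ∀ i, 0 ≤ (c i).h ^ (k + 1) := fun i => pow_nonneg (c i).h_mem.1.le _
      have he : (fun i => ‖(c i).initError‖) =O[⊤]
          fun i => ‖(c i).initError‖ + (c i).h ^ (k + 1) :=
        isBigO_left_add (fun i => norm_nonneg _) hnonneg
      have hpow : (fun i => (c i).h ^ (k + 1)) =O[⊤]
          fun i => ‖(c i).initError‖ + (c i).h ^ (k + 1) :=
        isBigO_right_add (fun i => norm_nonneg _) hnonneg
      have hslopes : (fun i => (c i).h • ∑ l, collA γ j l • (c i).slopeError l) =O[⊤]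
          fun i => (c i).h * (‖(c i).initError‖ + (c i).h ^ k) :=
        (isBigO_refl (fun i => (c i).h) ⊤).smul (IsBigO.fun_sum fun l _ =>
          ((isBigO_slopeError hf hγ hρ c l).trans (ih (by omega) l)).const_smul_left _)
      have hgain : (fun i => (c i).h * (‖(c i).initError‖ + (c i).h ^ k)) =O[⊤]
          fun i => ‖(c i).initError‖ + (c i).h ^ (k + 1) := by
        simp only [mul_add, ← pow_succ']
        refine IsBigO.add ?_ hpow
        simpa only [one_mul] using (isBigO_h c).mul he
      simp only [stageError_eq]
      exact (he.of_norm_left.add (hslopes.trans hgain)).sub ((isBigO_stageDefect hy hf hγ c j).trans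
        ((isBigO_pow_pow (isBigO_h c) hk).trans hpow))
  exact hbootstrap _ le_rfl j

lemma isBigO_stageError_pow (hy : SolvesODE f T y) (hf : ContDiff ℝ ∞ f) (hγ : IsGaussNodes γ)
    (hρ : ∀ t ∈ Icc 0 T, ‖y t‖ ≤ ρ) {c : ι → CollStep γ f y T ρ} {m : ℕ} (hm : m ≤ s + 1)
    (he : (fun i => (c i).initError) =O[⊤] fun i => (c i).h ^ m) (j : Fin s) :
    (fun i => (c i).stageError j) =O[⊤] fun i => (c i).h ^ m :=
  (isBigO_stageError hy hf hγ hρ c j).trans (he.norm_left.add (isBigO_pow_pow (isBigO_h c) hm))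

end Proper

end CollStep

end CollStep

namespace CollStep

section LocalError

variable {s : ℕ} {V : Type*} [NormedAddCommGroup V] [NormedSpace ℝ V]
  {γ : Fin s → ℝ} {f : V → V} {y : ℝ → V} {T ρ : ℝ}

/-- The error of the collocation polynomial at the time `τ`, in the time scale of the step. -/
def errorCurve (c : CollStep γ f y T ρ) (τ : ℝ) : V :=
  c.v + c.h • ∑ j, (collPoly γ j).eval τ • f (c.Y j) - y (c.a + c.h * τ)

/-- The error of the interpolated slopes at the time `τ`, in the time scale of the step. -/
def slopeErrorCurve (c : CollStep γ f y T ρ) (τ : ℝ) : V :=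
  ∑ j, (Lagrange.basis Finset.univ γ j).eval τ • f (c.Y j) - f (y (c.a + c.h * τ))

/-- The derivative of the vector field along the exact solution. -/
def jacobian (c : CollStep γ f y T ρ) (τ : ℝ) : V →L[ℝ] V := fderiv ℝ f (y (c.a + c.h * τ))

lemma errorCurve_zero (c : CollStep γ f y T ρ) : c.errorCurve 0 = c.initError := by
  simp [errorCurve, initError, eval_zero_collPoly]

lemma errorCurve_node (c : CollStep γ f y T ρ) (j : Fin s) :
    c.errorCurve (γ j) = c.stageError j := by
  simp only [errorCurve, stageError, ← collA_eq]
  rw [← c.isStages j]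

lemma errorCurve_one (c : CollStep γ f y T ρ) : c.errorCurve 1 = c.nextError := by
  simp [errorCurve, nextError, collNext, collB_eq]

lemma slopeErrorCurve_node (hγ : Function.Injective γ) (c : CollStep γ f y T ρ) (j : Fin s) :
    c.slopeErrorCurve (γ j) = c.slopeError j := by
  have hbasis : ∀ l, (Lagrange.basis Finset.univ γ l).eval (γ j) • f (c.Y l) =
      if l = j then f (c.Y l) else 0 := fun l => by
    split_ifs with hl
    · rw [hl, Lagrange.eval_basis_self hγ.injOn (Finset.mem_univ j), one_smul]
    · rw [Lagrange.eval_basis_of_ne hl (Finset.mem_univ j), zero_smul]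
  simp [slopeErrorCurve, slopeError, hbasis]

lemma hasDerivWithinAt_errorCurve (hy : SolvesODE f T y) (c : CollStep γ f y T ρ) {τ : ℝ}
    (hτ : τ ∈ Icc (0 : ℝ) 1) :
    HasDerivWithinAt c.errorCurve (c.h • c.slopeErrorCurve τ) (Icc 0 1) τ := by
  have hpoly : HasDerivWithinAt (fun τ => ∑ j, (collPoly γ j).eval τ • f (c.Y j))
      (∑ j, (Lagrange.basis Finset.univ γ j).eval τ • f (c.Y j)) (Icc 0 1) τ :=
    HasDerivWithinAt.fun_sum fun j _ => by
      simpa only [derivative_collPoly] using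
        (((collPoly γ j).hasDerivAt τ).smul_const (f (c.Y j))).hasDerivWithinAt
  have hexact := hy.hasDerivWithinAt_rescaled contDiff_id (fun _ => c.time_mem) hτ
  rw [lieDeriv_id] at hexact
  exact (((hpoly.const_smul c.h).const_add c.v).sub hexact).congr_deriv (smul_sub _ _ _).symm

lemma continuousOn_jacobian (hy : SolvesODE f T y) (hf : ContDiff ℝ ∞ f)
    (c : CollStep γ f y T ρ) : ContinuousOn c.jacobian (Icc 0 1) := fun _ hτ =>
  (hy.hasDerivWithinAt_rescaled (hf.fderiv_right (m := ∞) (by simp)) (fun _ => c.time_mem)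
    hτ).continuousWithinAt

variable {ι : Type*}

lemma hasUnifExpansion_jacobian (hy : SolvesODE f T y) (hf : ContDiff ℝ ∞ f)
    (c : ι → CollStep γ f y T ρ) (m : ℕ) :
    HasUnifExpansion (fun i => (c i).h) m fun i => (c i).jacobian :=
  hy.hasUnifExpansion hf (isBigO_h c) (fun i _ => (c i).time_mem)
    (hf.fderiv_right (m := ∞) (by simp)) m

lemma isBigO_jacobian_node (hy : SolvesODE f T y) (hf : ContDiff ℝ ∞ f) (hγ : IsGaussNodes γ)
    (c : ι → CollStep γ f y T ρ) (j : Fin s) :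
    (fun i => (c i).jacobian (γ j)) =O[⊤] fun _ => (1 : ℝ) :=
  isBigO_comp_prodMk ((hasUnifExpansion_jacobian hy hf c 0).isBigO_one (isBigO_h c))
    ⟨γ j, Ioo_subset_Icc_self (hγ.mem_Ioo j)⟩

section Proper

variable [ProperSpace V]

/-- The slope errors at the stages are `O(h ^ s)` and multiply polynomials of degree less than `s`
in the time of the step, so these terms stay bounded in terms of the physical time. -/
lemma hasUnifExpansion_slopeErrorCurve (hy : SolvesODE f T y) (hf : ContDiff ℝ ∞ f)
    (hγ : IsGaussNodes γ) (hρ : ∀ t ∈ Icc 0 T, ‖y t‖ ≤ ρ) (c : ι → CollStep γ f y T ρ) (m : ℕ) :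
    HasUnifExpansion (fun i => (c i).h) m fun i => (c i).slopeErrorCurve := by
  have hh0 : ∀ i, (c i).h ≠ 0 := fun i => (c i).h_mem.1.ne'
  have hslope : ∀ j, (fun i => (c i).slopeError j) =O[⊤] fun i => (c i).h ^ s := fun j =>
    (isBigO_slopeError hf hγ hρ c j).trans
      (isBigO_stageError_pow hy hf hγ hρ s.le_succ (isBigO_initError c) j)
  have hexact := hy.hasUnifExpansion hf (isBigO_h c) (fun i _ => (c i).time_mem) hf m
  have hinterp := hexact.interpolate (isBigO_h c) hh0 hγ.1
    fun j => Ioo_subset_Icc_self (hγ.mem_Ioo j)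
  have hdiff := HasUnifExpansion.sum (A := Finset.univ) fun j _ =>
    HasUnifExpansion.eval_smul (isBigO_h c) hh0 (natDegree_basis_univ_lt hγ.1 j).le (hslope j) m
  refine ((hdiff.add hinterp).sub hexact).congr fun i τ => ?_
  simp only [slopeError, slopeErrorCurve, smul_sub, Finset.sum_sub_distrib, sub_add_cancel]

lemma hasUnifExpansion_errorCurve (hy : SolvesODE f T y) (hf : ContDiff ℝ ∞ f)
    (hγ : IsGaussNodes γ) (hρ : ∀ t ∈ Icc 0 T, ‖y t‖ ≤ ρ) (c : ι → CollStep γ f y T ρ) (m : ℕ) :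
    HasUnifExpansion (fun i => (c i).h) m fun i => (c i).errorCurve := by
  refine (HasUnifExpansion.of_hasDerivWithinAt (isBigO_h c)
    (hasUnifExpansion_slopeErrorCurve hy hf hγ hρ c m) ?_
    fun i _ hτ => (c i).hasDerivWithinAt_errorCurve hy hτ).mono (isBigO_h c) m.le_succ
  simpa only [errorCurve_zero, pow_zero] using
    (isBigO_initError c).trans (isBigO_pow_pow (isBigO_h c) s.zero_le)

end Proper

/-- The approximate solution operator of the variational equation `e' = h A e`, `A` the Jacobian,
from the time `τ` to the end of the step. -/
def transport (r : ℕ) (c : CollStep γ f y T ρ) : ℝ → V →L[ℝ] V := picard c.h c.jacobian r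

/-- `h` times this is the derivative of the transported error curve. -/
def transportedRate (r : ℕ) (c : CollStep γ f y T ρ) (τ : ℝ) : V :=
  c.transport (r + 1) τ (c.slopeErrorCurve τ) - c.transport r τ (c.jacobian τ (c.errorCurve τ))

lemma hasDerivWithinAt_transport_errorCurve [CompleteSpace V] (hy : SolvesODE f T y)
    (hf : ContDiff ℝ ∞ f) (r : ℕ) (c : CollStep γ f y T ρ) {τ : ℝ} (hτ : τ ∈ Icc (0 : ℝ) 1) :
    HasDerivWithinAt (fun τ => c.transport (r + 1) τ (c.errorCurve τ))
      (c.h • c.transportedRate r τ) (Icc 0 1) τ := by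
  refine ((hasDerivWithinAt_picard_succ (c.continuousOn_jacobian hy hf) c.h r hτ).clm_apply
    (c.hasDerivWithinAt_errorCurve hy hτ)).congr_deriv ?_
  simp only [transportedRate, transport, smul_sub, smul_apply, neg_apply, map_smul, smul_neg,
    ContinuousLinearMap.comp_apply]
  abel

variable [ProperSpace V]

lemma hasUnifExpansion_transportedRate (hy : SolvesODE f T y) (hf : ContDiff ℝ ∞ f)
    (hγ : IsGaussNodes γ) (hρ : ∀ t ∈ Icc 0 T, ‖y t‖ ≤ ρ) (c : ι → CollStep γ f y T ρ) (r m : ℕ) :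
    HasUnifExpansion (fun i => (c i).h) m fun i => (c i).transportedRate r := by
  have hjac := hasUnifExpansion_jacobian hy hf c
  have htransport := hasUnifExpansion_picard (isBigO_h c)
    (fun i => (c i).continuousOn_jacobian hy hf) hjac
  exact .sub (.bilin (isBigO_h c) (.id ℝ _) (htransport (r + 1) m)
    (hasUnifExpansion_slopeErrorCurve hy hf hγ hρ c m))
    (.bilin (isBigO_h c) (.id ℝ _) (htransport r m) (.bilin (isBigO_h c) (.id ℝ _) (hjac m)
      (hasUnifExpansion_errorCurve hy hf hγ hρ c m)))

/-- At the stages the slope error is the linearized stage error up to a quadratic term, and two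
successive Picard iterates differ by `O(h ^ (r + 1))`. -/
lemma isBigO_slopeError_sub_jacobian (hf : ContDiff ℝ ∞ f) (hγ : IsGaussNodes γ)
    (hρ : ∀ t ∈ Icc 0 T, ‖y t‖ ≤ ρ) (c : ι → CollStep γ f y T ρ) (j : Fin s) :
    (fun i => (c i).slopeError j - (c i).jacobian (γ j) ((c i).stageError j)) =O[⊤]
      fun i => ‖(c i).stageError j‖ ^ 2 :=
  isBigO_comp_sub_comp_sub_fderiv hf (fun i => (c i).norm_Y_le j)
    fun i => hρ _ ((c i).time_mem (Ioo_subset_Icc_self (hγ.mem_Ioo j)))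

lemma isBigO_transportedRate_node (hy : SolvesODE f T y) (hf : ContDiff ℝ ∞ f)
    (hγ : IsGaussNodes γ) (hρ : ∀ t ∈ Icc 0 T, ‖y t‖ ≤ ρ) (c : ι → CollStep γ f y T ρ) (r : ℕ)
    (j : Fin s) : (fun i => (c i).transportedRate r (γ j)) =O[⊤] fun i =>
      ‖(c i).stageError j‖ ^ 2 + (c i).h ^ (r + 1) * ‖(c i).stageError j‖ := by
  have hnode := Ioo_subset_Icc_self (hγ.mem_Ioo j)
  have hjac := hasUnifExpansion_jacobian hy hf c
  have hA := fun i => (c i).continuousOn_jacobian hy hf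
  have htransport := isBigO_comp_prodMk ((hasUnifExpansion_picard (isBigO_h c) hA hjac (r + 1)
    0).isBigO_one (isBigO_h c)) ⟨γ j, hnode⟩
  have hsucc := isBigO_comp_prodMk (isBigO_picard_succ_sub (isBigO_h c) hA hjac r) ⟨γ j, hnode⟩
  have hsq := isBigO_clm_apply₂ (.id ℝ _) htransport (isBigO_slopeError_sub_jacobian hf hγ hρ c j)
  have hlin := isBigO_clm_apply₂ (.id ℝ _) hsucc (isBigO_clm_apply₂ (.id ℝ _)
    (isBigO_jacobian_node hy hf hγ c j) (isBigO_refl (fun i => (c i).stageError j) ⊤).norm_right)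
  simp only [one_mul] at hsq hlin
  have hnonneg : ∀ i, 0 ≤ (c i).h := fun i => (c i).h_mem.1.le
  refine ((hsq.trans (isBigO_left_add (fun i => sq_nonneg _) fun i => ?_)).add
    (hlin.trans (isBigO_right_add (fun i => sq_nonneg _) fun i => ?_))).congr_left fun i => ?_
  · exact mul_nonneg (pow_nonneg (hnonneg i) _) (norm_nonneg _)
  · exact mul_nonneg (pow_nonneg (hnonneg i) _) (norm_nonneg _)
  · simp only [transportedRate, transport, slopeErrorCurve_node hγ.1, errorCurve_node,
      ContinuousLinearMap.id_apply, map_sub, sub_apply]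
    abel

lemma isBigO_sum_transportedRate (hy : SolvesODE f T y) (hf : ContDiff ℝ ∞ f)
    (hγ : IsGaussNodes γ) (hρ : ∀ t ∈ Icc 0 T, ‖y t‖ ≤ ρ) (c : ι → CollStep γ f y T ρ) {r : ℕ}
    (hr : s = r + 1) (B : Fin s → ℝ) :
    (fun i => ∑ j, B j • (c i).transportedRate r (γ j)) =O[⊤] fun i =>
      (c i).h ^ s * (‖(c i).initError‖ + (c i).h ^ (s + 1)) := by
  subst hr
  refine IsBigO.fun_sum fun j _ => IsBigO.const_smul_left ?_ _
  have hη := isBigO_stageError hy hf hγ hρ c j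
  have hη_pow := isBigO_stageError_pow hy hf hγ hρ (Nat.le_succ _) (isBigO_initError c) j
  refine (isBigO_transportedRate_node hy hf hγ hρ c r j).trans (IsBigO.add ?_ ?_)
  · simpa only [sq] using hη_pow.norm_left.mul hη.norm_left
  · exact (isBigO_refl _ _).mul hη.norm_left

lemma isBigO_nextError_sub_initError (hs : 1 ≤ s) (hy : SolvesODE f T y) (hf : ContDiff ℝ ∞ f)
    (hγ : IsGaussNodes γ) (hρ : ∀ t ∈ Icc 0 T, ‖y t‖ ≤ ρ) (c : ι → CollStep γ f y T ρ) :
    (fun i => (c i).nextError - (c i).initError) =O[⊤] fun i =>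
      (c i).h * ‖(c i).initError‖ + (c i).h ^ (2 * s + 1) := by
  obtain ⟨r, rfl⟩ := Nat.exists_eq_add_of_le' hs
  have hnode : ∀ j, γ j ∈ Icc (0 : ℝ) 1 := fun j => Ioo_subset_Icc_self (hγ.mem_Ioo j)
  have hh : ∀ i, 0 ≤ (c i).h := fun i => (c i).h_mem.1.le
  set b : ι → ℝ := fun i => (c i).h * ‖(c i).initError‖ + (c i).h ^ (2 * (r + 1) + 1)
  have hb_left : (fun i => (c i).h * ‖(c i).initError‖) =O[⊤] b := isBigO_left_add
    (fun i => mul_nonneg (hh i) (norm_nonneg _)) fun i => pow_nonneg (hh i) _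
  have hb_right : (fun i => (c i).h ^ (2 * (r + 1) + 1)) =O[⊤] b := isBigO_right_add
    (fun i => mul_nonneg (hh i) (norm_nonneg _)) fun i => pow_nonneg (hh i) _
  have hquad := HasUnifExpansion.isBigO_quadrature (A := collB γ) (t := 1)
    (hasUnifExpansion_transportedRate hy hf hγ hρ c r (2 * (r + 1))) hnode (by simp)
    (fun k hk => by simpa using hγ.sum_collB_mul_pow hk)
    (fun i _ => (c i).hasDerivWithinAt_transport_errorCurve hy hf r)
  have hrates : (fun i => (c i).h • ∑ j, collB γ j • (c i).transportedRate r (γ j)) =O[⊤] b := by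
    refine ((isBigO_refl _ _).smul
      (isBigO_sum_transportedRate hy hf hγ hρ c rfl (collB γ))).trans ?_
    have hone : ∀ k, (fun i => (c i).h ^ k) =O[⊤] fun _ => (1 : ℝ) := fun k => by
      simpa only [pow_zero] using isBigO_pow_pow (isBigO_h c) k.zero_le
    refine (((hone (r + 1)).mul hb_left).add ((hone 1).mul hb_right)).congr (fun i => ?_)
      fun i => by ring
    simp only [smul_eq_mul]
    ring
  have hzero : (fun i => ((c i).transport (r + 1) 0 - 1) (c i).initError) =O[⊤] b := by
    have hsub := isBigO_comp_prodMk (isBigO_picard_sub_one (isBigO_h c)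
      (fun i => (c i).continuousOn_jacobian hy hf) (hasUnifExpansion_jacobian hy hf c)
      (r + 1)) ⟨0, by simp⟩
    exact (isBigO_clm_apply₂ (.id ℝ _) hsub (isBigO_refl _ _).norm_right).trans hb_left
  refine (((hquad.trans hb_right).add hrates).add hzero).congr_left fun i => ?_
  simp [transport, picard_one, errorCurve_zero, errorCurve_one]

end LocalError

end CollStep

namespace CollStep

section Extrapolation

variable {s : ℕ} {V : Type*} [NormedAddCommGroup V] [NormedSpace ℝ V]
  {γ : Fin s → ℝ} {f : V → V} {y : ℝ → V} {T ρ : ℝ}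

/-- The error at the end of the step of the slope extrapolated from the exact initial slope and the
slopes at the stages. -/
def extrapolationError (c : CollStep γ f y T ρ) : V :=
  (-1 : ℝ) ^ s • f (y c.a) + ∑ j, extrapolationWeights γ j • f (c.Y j) - f (y (c.a + c.h))

/-- The error of the extrapolation of the exact slopes. -/
def extrapolationDefect (c : CollStep γ f y T ρ) : V :=
  (-1 : ℝ) ^ s • f (y c.a) + ∑ j, extrapolationWeights γ j • f (y (c.a + c.h * γ j)) -
    f (y (c.a + c.h))

lemma extrapolationError_eq (c : CollStep γ f y T ρ) :
    c.extrapolationError =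
      c.extrapolationDefect + ∑ j, extrapolationWeights γ j • c.slopeError j := by
  simp only [extrapolationError, extrapolationDefect, slopeError, smul_sub, Finset.sum_sub_distrib]
  abel

/-- The step `c'` has the same size as `c` and starts from where `c` ends. -/
def IsFollowedBy (c c' : CollStep γ f y T ρ) : Prop :=
  c'.h = c.h ∧ c'.a = c.a + c.h ∧ c'.v = collNext γ f c.h c.v c.Y

lemma IsFollowedBy.initError_eq {c c' : CollStep γ f y T ρ} (hcc' : c.IsFollowedBy c') :
    c'.initError = c.nextError := by
  rw [initError, hcc'.2.2, hcc'.2.1, nextError]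

lemma IsFollowedBy.time_mem {c c' : CollStep γ f y T ρ} (hcc' : c.IsFollowedBy c') {τ : ℝ}
    (hτ : τ ∈ Icc (0 : ℝ) 1) : c.a + c.h + c.h * τ ∈ Icc 0 T := by
  simpa only [hcc'.1, hcc'.2.1] using c'.time_mem hτ

variable {ι : Type*} {c c' : ι → CollStep γ f y T ρ}

lemma isBigO_extrapolationDefect (hy : SolvesODE f T y) (hf : ContDiff ℝ ∞ f)
    (hγ : IsGaussNodes γ) (c : ι → CollStep γ f y T ρ) :
    (fun i => (c i).extrapolationDefect) =O[⊤] fun i => (c i).h ^ (s + 1) := by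
  have hexp := hy.hasUnifExpansion hf (isBigO_h c) (fun i _ => (c i).time_mem) hf (s + 1)
  refine (hexp.isBigO_extrapolation (fun j => Ioo_subset_Icc_self (hγ.mem_Ioo j)) fun k hk =>
    hγ.neg_one_pow_mul_zero_pow_add (Nat.lt_succ_iff.mp hk)).congr_left fun i => ?_
  simp only [extrapolationDefect, mul_zero, add_zero, mul_one]

lemma isBigO_stageDefect_sub (hy : SolvesODE f T y) (hf : ContDiff ℝ ∞ f) (hγ : IsGaussNodes γ)
    (hcc' : ∀ i, (c i).IsFollowedBy (c' i)) (j : Fin s) :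
    (fun i => (c' i).stageDefect j - (c i).stageDefect j) =O[⊤] fun i => (c i).h ^ (s + 2) := by
  have hnode : ∀ j, γ j ∈ Icc (0 : ℝ) 1 := fun j => Ioo_subset_Icc_self (hγ.mem_Ioo j)
  have hquad := HasUnifExpansion.isBigO_quadrature (A := collA γ j) (t := γ j)
    (hy.hasUnifExpansion_diffQuot hf (isBigO_h c) (fun i _ => (c i).time_mem)
      (fun i _ => (hcc' i).time_mem) hf s) hnode (hnode j)
    (fun k hk => by simpa only [collA_eq] using sum_collPoly_mul_pow hγ.1 hk (γ j))
    (fun i τ hτ => by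
      simpa only [lieDeriv_id, id] using hy.hasDerivWithinAt_diffQuot contDiff_id
        (fun _ => (c i).time_mem) (fun _ => (hcc' i).time_mem) hτ)
  refine ((isBigO_refl (fun i => (c i).h) ⊤).smul hquad).congr (fun i => ?_)
    fun i => (pow_succ' _ _).symm
  have hh := (c i).h_mem.1.ne'
  have hcancel : ∀ (r : ℝ) (x : V), (c i).h • r • (c i).h⁻¹ • x = r • x := fun r x => by
    rw [smul_comm, smul_inv_smul₀ hh]
  have hsum : ∀ x : Fin s → V, (c i).h • ∑ l, collA γ j l • (c i).h⁻¹ • x l =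
      ∑ l, collA γ j l • x l := fun x => by simp only [Finset.smul_sum, hcancel]
  simp only [stageDefect, (hcc' i).1, (hcc' i).2.1, mul_zero, add_zero]
  rw [smul_sub, smul_sub, smul_inv_smul₀ hh, smul_inv_smul₀ hh, hsum]
  simp only [smul_sub, Finset.sum_sub_distrib]
  abel

lemma isBigO_extrapolationDefect_sub (hy : SolvesODE f T y) (hf : ContDiff ℝ ∞ f)
    (hγ : IsGaussNodes γ) (hcc' : ∀ i, (c i).IsFollowedBy (c' i)) :
    (fun i => (c' i).extrapolationDefect - (c i).extrapolationDefect) =O[⊤]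
      fun i => (c i).h ^ (s + 2) := by
  have hexp := hy.hasUnifExpansion_diffQuot hf (isBigO_h c) (fun i _ => (c i).time_mem)
    (fun i _ => (hcc' i).time_mem) hf (s + 1)
  refine ((isBigO_refl (fun i => (c i).h) ⊤).smul (hexp.isBigO_extrapolation
    (fun j => Ioo_subset_Icc_self (hγ.mem_Ioo j)) fun k hk => hγ.neg_one_pow_mul_zero_pow_add
      (Nat.lt_succ_iff.mp hk))).congr (fun i => ?_) fun i => (pow_succ' _ _).symm
  have hh := (c i).h_mem.1.ne'
  have hcancel : ∀ (r : ℝ) (x : V), (c i).h • r • (c i).h⁻¹ • x = r • x := fun r x => by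
    rw [smul_comm, smul_inv_smul₀ hh]
  simp only [extrapolationDefect, (hcc' i).1, (hcc' i).2.1, mul_zero, add_zero, mul_one,
    smul_add, smul_sub, Finset.smul_sum, smul_inv_smul₀ hh, hcancel, Finset.sum_sub_distrib]
  abel

lemma isBigO_jacobian_sub (hy : SolvesODE f T y) (hf : ContDiff ℝ ∞ f) (hγ : IsGaussNodes γ)
    (hcc' : ∀ i, (c i).IsFollowedBy (c' i)) (j : Fin s) :
    (fun i => (c' i).jacobian (γ j) - (c i).jacobian (γ j)) =O[⊤] fun i => (c i).h := by
  have hnode := Ioo_subset_Icc_self (hγ.mem_Ioo j)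
  obtain ⟨C, hC⟩ := hy.exists_norm_comp_sub_le hf.continuous
    (hf.fderiv_right (m := ∞) (by simp))
  refine isBigO_top.mpr ⟨C, fun i => ?_⟩
  have hdiff := hC _ ((c i).time_mem hnode) _ ((c' i).time_mem hnode)
  simpa only [jacobian, (hcc' i).1, (hcc' i).2.1, add_right_comm _ (c i).h, add_sub_cancel_left,
    Real.norm_eq_abs] using hdiff

variable [ProperSpace V]

lemma isBigO_extrapolationError (hy : SolvesODE f T y) (hf : ContDiff ℝ ∞ f)
    (hγ : IsGaussNodes γ) (hρ : ∀ t ∈ Icc 0 T, ‖y t‖ ≤ ρ)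
    (he : (fun i => (c i).initError) =O[⊤] fun i => (c i).h ^ (s + 1)) :
    (fun i => (c i).extrapolationError) =O[⊤] fun i => (c i).h ^ (s + 1) := by
  simp only [extrapolationError_eq]
  exact (isBigO_extrapolationDefect hy hf hγ c).add (IsBigO.fun_sum fun j _ =>
    ((isBigO_slopeError hf hγ hρ c j).trans
      (isBigO_stageError_pow hy hf hγ hρ le_rfl he j)).const_smul_left _)

lemma isBigO_initError_sub (hs : 1 ≤ s) (hy : SolvesODE f T y) (hf : ContDiff ℝ ∞ f)
    (hγ : IsGaussNodes γ) (hρ : ∀ t ∈ Icc 0 T, ‖y t‖ ≤ ρ) (hcc' : ∀ i, (c i).IsFollowedBy (c' i))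
    (he : (fun i => (c i).initError) =O[⊤] fun i => (c i).h ^ (s + 1)) :
    (fun i => (c' i).initError - (c i).initError) =O[⊤] fun i => (c i).h ^ (s + 2) := by
  simp only [(hcc' _).initError_eq]
  refine (isBigO_nextError_sub_initError hs hy hf hγ hρ c).trans
    (IsBigO.add ?_ (isBigO_pow_pow (isBigO_h c) (by omega)))
  simpa only [← pow_succ'] using (isBigO_refl (fun i => (c i).h) ⊤).mul he.norm_left

lemma isBigO_initError_of_isFollowedBy (hs : 1 ≤ s) (hy : SolvesODE f T y) (hf : ContDiff ℝ ∞ f)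
    (hγ : IsGaussNodes γ) (hρ : ∀ t ∈ Icc 0 T, ‖y t‖ ≤ ρ) (hcc' : ∀ i, (c i).IsFollowedBy (c' i))
    (he : (fun i => (c i).initError) =O[⊤] fun i => (c i).h ^ (s + 1)) :
    (fun i => (c' i).initError) =O[⊤] fun i => (c' i).h ^ (s + 1) := by
  have hsub := (isBigO_initError_sub hs hy hf hγ hρ hcc' he).trans
    (isBigO_pow_pow (isBigO_h c) (Nat.le_succ (s + 1)))
  simpa only [(hcc' _).1, add_sub_cancel] using he.add hsub

lemma isBigO_stageError_sub (hs : 1 ≤ s) (hy : SolvesODE f T y) (hf : ContDiff ℝ ∞ f)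
    (hγ : IsGaussNodes γ) (hρ : ∀ t ∈ Icc 0 T, ‖y t‖ ≤ ρ) (hcc' : ∀ i, (c i).IsFollowedBy (c' i))
    (he : (fun i => (c i).initError) =O[⊤] fun i => (c i).h ^ (s + 1)) (j : Fin s) :
    (fun i => (c' i).stageError j - (c i).stageError j) =O[⊤] fun i => (c i).h ^ (s + 2) := by
  have hsub := isBigO_initError_sub hs hy hf hγ hρ hcc' he
  have he' := isBigO_initError_of_isFollowedBy hs hy hf hγ hρ hcc' he
  have hh : ∀ i, (c' i).h = (c i).h := fun i => (hcc' i).1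
  have hslope : ∀ l, (fun i => (c i).slopeError l) =O[⊤] fun i => (c i).h ^ (s + 1) := fun l =>
    (isBigO_slopeError hf hγ hρ c l).trans (isBigO_stageError_pow hy hf hγ hρ le_rfl he l)
  have hslope' : ∀ l, (fun i => (c' i).slopeError l) =O[⊤] fun i => (c i).h ^ (s + 1) := fun l => by
    simpa only [hh] using
      (isBigO_slopeError hf hγ hρ c' l).trans (isBigO_stageError_pow hy hf hγ hρ le_rfl he' l)
  have hslopes : (fun i => ∑ l, collA γ j l • ((c' i).slopeError l - (c i).slopeError l)) =O[⊤]
      fun i => (c i).h ^ (s + 1) :=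
    IsBigO.fun_sum fun l _ => ((hslope' l).sub (hslope l)).const_smul_left _
  refine ((hsub.add (((isBigO_refl (fun i => (c i).h) ⊤).smul hslopes).congr_right fun i =>
    (pow_succ' _ _).symm)).sub (isBigO_stageDefect_sub hy hf hγ hcc' j)).congr_left fun i => ?_
  simp only [stageError_eq, hh, smul_sub, Finset.sum_sub_distrib]
  abel

lemma isBigO_slopeError_sub (hs : 1 ≤ s) (hy : SolvesODE f T y) (hf : ContDiff ℝ ∞ f)
    (hγ : IsGaussNodes γ) (hρ : ∀ t ∈ Icc 0 T, ‖y t‖ ≤ ρ) (hcc' : ∀ i, (c i).IsFollowedBy (c' i))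
    (he : (fun i => (c i).initError) =O[⊤] fun i => (c i).h ^ (s + 1)) (j : Fin s) :
    (fun i => (c' i).slopeError j - (c i).slopeError j) =O[⊤] fun i => (c i).h ^ (s + 2) := by
  have he' := isBigO_initError_of_isFollowedBy hs hy hf hγ hρ hcc' he
  have hη := isBigO_stageError_pow hy hf hγ hρ le_rfl he j
  have hη' : (fun i => (c' i).stageError j) =O[⊤] fun i => (c i).h ^ (s + 1) := by
    simpa only [(hcc' _).1] using isBigO_stageError_pow hy hf hγ hρ le_rfl he' j
  have hsq : ∀ {η : ι → V}, η =O[⊤] (fun i => (c i).h ^ (s + 1)) →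
      (fun i => ‖η i‖ ^ 2) =O[⊤] fun i => (c i).h ^ (s + 2) := fun hη => by
    refine (hη.norm_left.pow 2).trans ?_
    simpa only [← pow_mul] using isBigO_pow_pow (isBigO_h c) (by omega : s + 2 ≤ (s + 1) * 2)
  have hrem := (isBigO_slopeError_sub_jacobian hf hγ hρ c j).trans (hsq hη)
  have hrem' := (isBigO_slopeError_sub_jacobian hf hγ hρ c' j).trans (hsq hη')
  have hlin := isBigO_clm_apply₂ (.id ℝ _) (isBigO_jacobian_node hy hf hγ c j)
    (isBigO_stageError_sub hs hy hf hγ hρ hcc' he j)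
  have hjac := isBigO_clm_apply₂ (.id ℝ _) (isBigO_jacobian_sub hy hf hγ hcc' j) hη'
  simp only [one_mul, ← pow_succ'] at hlin hjac
  refine (((hrem'.sub hrem).add hlin).add hjac).congr_left fun i => ?_
  simp only [ContinuousLinearMap.id_apply, map_sub, sub_apply]
  abel

lemma isBigO_extrapolationError_sub (hs : 1 ≤ s) (hy : SolvesODE f T y) (hf : ContDiff ℝ ∞ f)
    (hγ : IsGaussNodes γ) (hρ : ∀ t ∈ Icc 0 T, ‖y t‖ ≤ ρ) (hcc' : ∀ i, (c i).IsFollowedBy (c' i))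
    (he : (fun i => (c i).initError) =O[⊤] fun i => (c i).h ^ (s + 1)) :
    (fun i => (c' i).extrapolationError - (c i).extrapolationError) =O[⊤]
      fun i => (c i).h ^ (s + 2) := by
  have hslopes : (fun i => ∑ j, extrapolationWeights γ j •
      ((c' i).slopeError j - (c i).slopeError j)) =O[⊤] fun i => (c i).h ^ (s + 2) :=
    IsBigO.fun_sum fun j _ =>
      (isBigO_slopeError_sub hs hy hf hγ hρ hcc' he j).const_smul_left _
  refine ((isBigO_extrapolationDefect_sub hy hf hγ hcc').add hslopes).congr_left fun i => ?_
  simp only [extrapolationError_eq, smul_sub, Finset.sum_sub_distrib]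
  abel

end Extrapolation

end CollStep

lemma eventually_mul_le (K : ℝ) {ε : ℝ} (hε : 0 < ε) : ∀ᶠ h in 𝓝[>] (0 : ℝ), h * K ≤ ε := by
  have hlim : Tendsto (fun h : ℝ => h * K) (𝓝 0) (𝓝 (0 * K)) := tendsto_id.mul_const K
  rw [zero_mul] at hlim
  exact nhdsWithin_le_nhds (hlim.eventually (eventually_le_nhds hε))

lemma eventually_exists_eq_add_smul {V : Type*} [NormedAddCommGroup V] [NormedSpace ℝ V]
    [ProperSpace V] {G : V → V} (hG : ContDiff ℝ ∞ G) (ρ : ℝ) :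
    ∀ᶠ h in 𝓝[>] (0 : ℝ), ∀ u : V, ‖u‖ ≤ ρ → ∃ Y, Y = u + h • G Y := by
  let S := Metric.closedBall (0 : V) (ρ + 1)
  obtain ⟨L, hL⟩ := isBigO_top.mp (isBigO_comp_sub_comp (ρ := ρ + 1) hG
    (u := fun x : S × S => (x.1 : V)) (v := fun x => (x.2 : V))
    (fun x => mem_closedBall_zero_iff.mp x.1.2) fun x => mem_closedBall_zero_iff.mp x.2.2)
  obtain ⟨B, hB⟩ := (isCompact_closedBall (0 : V) (ρ + 1)).exists_bound_of_continuousOn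
    hG.continuous.continuousOn
  filter_upwards [eventually_mul_le L one_half_pos, eventually_mul_le B one_pos,
    self_mem_nhdsWithin] with h hhL hhB (hh : 0 < h) u hu
  have hball : Metric.closedBall u 1 ⊆ S := Metric.closedBall_subset_closedBall' (by
    rw [dist_zero_right]; linarith)
  have hmaps : MapsTo (fun Y => u + h • G Y) (Metric.closedBall u 1) (Metric.closedBall u 1) :=
    fun Y hY => by
      rw [mem_closedBall_iff_norm, add_sub_cancel_left, norm_smul, Real.norm_of_nonneg hh.le]
      exact (mul_le_mul_of_nonneg_left (hB Y (hball hY)) hh.le).trans hhB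
  have hcontr : ContractingWith (1 / 2) (hmaps.restrict _ _ _) := by
    refine ⟨by norm_num, LipschitzWith.of_dist_le_mul fun Y Y' => ?_⟩
    rw [Subtype.dist_eq, Subtype.dist_eq, dist_eq_norm, dist_eq_norm, MapsTo.val_restrict_apply,
      MapsTo.val_restrict_apply, add_sub_add_left_eq_sub, ← smul_sub, norm_smul,
      Real.norm_of_nonneg hh.le]
    calc h * ‖G Y - G Y'‖ ≤ h * (L * ‖(Y : V) - Y'‖) :=
          mul_le_mul_of_nonneg_left (hL (⟨Y, hball Y.2⟩, ⟨Y', hball Y'.2⟩)) hh.le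
      _ = h * L * ‖(Y : V) - Y'‖ := (mul_assoc _ _ _).symm
      _ ≤ 1 / 2 * ‖(Y : V) - Y'‖ := mul_le_mul_of_nonneg_right hhL (norm_nonneg _)
      _ = _ := by simp
  obtain ⟨Y, -, hY, -⟩ := hcontr.exists_fixedPoint' Metric.isClosed_closedBall.isComplete hmaps
    (Metric.mem_closedBall_self zero_le_one) (edist_ne_top _ _)
  exact ⟨Y, hY.symm⟩

section Convergence

variable {s : ℕ} {V : Type*} [NormedAddCommGroup V] [NormedSpace ℝ V]
  {γ : Fin s → ℝ} {f : V → V} {y : ℝ → V} {T ρ : ℝ}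

lemma eventually_exists_isStages [ProperSpace V] (hf : ContDiff ℝ ∞ f) (γ : Fin s → ℝ) (ρ : ℝ) :
    ∀ᶠ h in 𝓝[>] (0 : ℝ), ∀ v : V, ‖v‖ ≤ ρ → ∃ Y, IsStages γ f h v Y := by
  have hG : ContDiff ℝ ∞ fun (Y : Fin s → V) i => ∑ j, collA γ i j • f (Y j) :=
    contDiff_pi.mpr fun i => ContDiff.sum fun j _ => (hf.comp (contDiff_apply ℝ V j)).const_smul _
  filter_upwards [eventually_exists_eq_add_smul hG ρ] with h hex v hv
  obtain ⟨Y, hY⟩ := hex (fun _ => v) ((pi_norm_const_le v).trans hv)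
  exact ⟨Y, congrFun hY⟩

/-- Uniformly in small steps, the stages of a step from a bounded set are bounded. For a general
vector field the stage equations may have further solutions that escape to infinity as the step
size tends to zero. -/
def HasBoundedStages (γ : Fin s → ℝ) (f : V → V) : Prop :=
  ∀ ρ, ∃ ρ', ∀ᶠ h in 𝓝[>] (0 : ℝ), ∀ v Y, ‖v‖ ≤ ρ → IsStages γ f h v Y → ∀ i, ‖Y i‖ ≤ ρ'

/-- `Y 0, …, Y (n - 1)` are the stages of `n` steps of size `h` through the values
`v 0, …, v n`. -/
structure IsCollSeq (γ : Fin s → ℝ) (f : V → V) (h : ℝ) (n : ℕ) (v : ℕ → V)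
    (Y : ℕ → Fin s → V) : Prop where
  isStages : ∀ m < n, IsStages γ f h (v m) (Y m)
  succ : ∀ m < n, v (m + 1) = collNext γ f h (v m) (Y m)

/-- The step `c` is the `m`-th of the steps of size `h` through the values `v` with stages `Y`,
when time starts at `0`. -/
def CollStep.IsNth (c : CollStep γ f y T ρ) (h : ℝ) (v : ℕ → V) (Y : ℕ → Fin s → V) (m : ℕ) :
    Prop :=
  c.h = h ∧ c.a = m * h ∧ c.v = v m ∧ c.Y = Y m

lemma HasBoundedStages.exists_isNth (hb : HasBoundedStages γ f) (hy : SolvesODE f T y) :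
    ∃ ρ, (∀ t ∈ Icc 0 T, ‖y t‖ ≤ ρ) ∧ ∀ᶠ h in 𝓝[>] (0 : ℝ), ∀ v Y m, ((m + 1 : ℕ) : ℝ) * h ≤ T →
      ‖v m - y (m * h)‖ ≤ h ^ s → IsStages γ f h (v m) (Y m) →
        ∃ c : CollStep γ f y T ρ, c.IsNth h v Y m := by
  obtain ⟨ρ₀, hρ₀⟩ := hy.exists_norm_comp_le (φ := id) continuous_id
  obtain ⟨ρ₁, hρ₁⟩ := hb (ρ₀ + 1)
  refine ⟨max ρ₀ ρ₁, fun t ht => (hρ₀ t ht).trans (le_max_left _ _), ?_⟩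
  filter_upwards [hρ₁, self_mem_nhdsWithin, eventually_mul_le 1 one_pos]
    with h hstages (hh : 0 < h) hh1 v Y m hm herr hY
  rw [mul_one] at hh1
  have hmh : 0 ≤ (m : ℝ) * h := by positivity
  rw [Nat.cast_succ, add_one_mul] at hm
  have hv : ‖v m‖ ≤ ρ₀ + 1 := by
    rw [← add_sub_cancel (y (m * h)) (v m)]
    exact norm_add_le_of_le (hρ₀ _ ⟨hmh, by linarith⟩) (herr.trans (pow_le_one₀ hh.le hh1))
  exact ⟨⟨h, m * h, v m, Y m, ⟨hh, hh1⟩, hmh, hm, herr,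
    fun i => (hstages _ _ hv hY i).trans (le_max_right _ _), hY⟩, rfl, rfl, rfl, rfl⟩

lemma CollStep.IsNth.initError_eq {c : CollStep γ f y T ρ} {h : ℝ} {v : ℕ → V}
    {Y : ℕ → Fin s → V} {m : ℕ} (hc : c.IsNth h v Y m) : c.initError = v m - y (m * h) := by
  rw [initError, hc.2.1, hc.2.2.1]

lemma CollStep.IsNth.nextError_eq {c : CollStep γ f y T ρ} {h : ℝ} {n : ℕ} {v : ℕ → V}
    {Y : ℕ → Fin s → V} (hseq : IsCollSeq γ f h n v Y) {m : ℕ} (hc : c.IsNth h v Y m)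
    (hm : m < n) : c.nextError = v (m + 1) - y ((m + 1 : ℕ) * h) := by
  rw [nextError, hc.1, hc.2.1, hc.2.2.1, hc.2.2.2, hseq.succ m hm, Nat.cast_succ, add_one_mul]

lemma CollStep.IsNth.isFollowedBy {c c' : CollStep γ f y T ρ} {h : ℝ} {n : ℕ} {v : ℕ → V}
    {Y : ℕ → Fin s → V} (hseq : IsCollSeq γ f h n v Y) {m : ℕ} (hc : c.IsNth h v Y m)
    (hc' : c'.IsNth h v Y (m + 1)) (hm : m < n) : c.IsFollowedBy c' := by
  refine ⟨hc'.1.trans hc.1.symm, ?_, ?_⟩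
  · rw [hc'.2.1, hc.2.1, hc.1, Nat.cast_succ, add_one_mul]
  · rw [hc'.2.2.1, hseq.succ m hm, hc.1, hc.2.2.1, hc.2.2.2]

variable {Z : Type*} [NormedAddCommGroup Z] [NormedSpace ℝ Z] {P : V →L[ℝ] Z}

/-- The values `z 0, …, z n` that `n` steps with the stages `Y` assign to an algebraic variable
which equals `P (f y)` along the solution. -/
def IsAlgebraicSeq (γ : Fin s → ℝ) (f : V → V) (P : V →L[ℝ] Z) (n : ℕ) (Y : ℕ → Fin s → V)
    (z : ℕ → Z) : Prop :=
  ∀ m < n, z (m + 1) = (-1 : ℝ) ^ s • z m + ∑ j, extrapolationWeights γ j • P (f (Y m j))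

lemma IsAlgebraicSeq.error_succ {h : ℝ} {n : ℕ} {v : ℕ → V} {Y : ℕ → Fin s → V} {z : ℕ → Z}
    (hz : IsAlgebraicSeq γ f P n Y z) {c : CollStep γ f y T ρ} {m : ℕ} (hm : m < n)
    (hc : c.IsNth h v Y m) :
    z (m + 1) - P (f (y ((m + 1 : ℕ) * h))) =
      (-1 : ℝ) ^ s • (z m - P (f (y (m * h)))) + P c.extrapolationError := by
  rw [hz m hm, CollStep.extrapolationError, hc.1, hc.2.1, hc.2.2.2, Nat.cast_succ, add_one_mul]
  simp only [map_sub, map_add, map_sum, map_smul, smul_sub]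
  abel

/-- The local error estimates hold only near the solution, so the recursion may be assumed only
while the bound holds. -/
lemma le_mul_exp_of_le_of_succ_le {u : ℕ → ℝ} {α β : ℝ} (hα : 0 ≤ α) (hβ : 0 ≤ β) {n : ℕ}
    (h0 : u 0 ≤ 0) (hu : ∀ m < n, u m ≤ β * m * Real.exp (α * m) →
      u (m + 1) ≤ (1 + α) * u m + β) {m : ℕ} (hm : m ≤ n) : u m ≤ β * m * Real.exp (α * m) := by
  induction m with
  | zero => simpa using h0
  | succ m ih =>
    have hum := ih (by omega)
    have hexp : Real.exp (α * (m + 1 : ℕ)) = Real.exp α * Real.exp (α * m) := by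
      rw [← Real.exp_add, Nat.cast_succ, mul_add_one, add_comm]
    have hone : 1 ≤ Real.exp (α * (m + 1 : ℕ)) := Real.one_le_exp (by positivity)
    calc u (m + 1) ≤ (1 + α) * u m + β := hu m (by omega) hum
      _ ≤ (α + 1) * (β * m * Real.exp (α * m)) + β := by rw [add_comm 1 α]; gcongr
      _ ≤ Real.exp α * (β * m * Real.exp (α * m)) + β := by gcongr; exact Real.add_one_le_exp α
      _ = β * m * Real.exp (α * (m + 1 : ℕ)) + β * 1 := by rw [hexp]; ring
      _ ≤ β * m * Real.exp (α * (m + 1 : ℕ)) + β * Real.exp (α * (m + 1 : ℕ)) := by gcongr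
      _ = _ := by push_cast; ring

lemma norm_le_of_norm_succ_add_le {E : Type*} [NormedAddCommGroup E] {ζ : ℕ → E} {n : ℕ}
    {δ ε : ℝ} (hδ : 0 ≤ δ) (hε : 0 ≤ ε) (h0 : ζ 0 = 0) (hadd : ∀ m < n, ‖ζ (m + 1) + ζ m‖ ≤ δ)
    (hsub : ∀ m, m + 1 < n → ‖ζ (m + 2) - ζ m‖ ≤ ε) : ∀ m ≤ n, ‖ζ m‖ ≤ δ + m * ε
  | 0, _ => by simpa [h0] using hδ
  | 1, hm => by
    have hone := hadd 0 hm
    rw [h0, add_zero] at hone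
    rw [Nat.cast_one, one_mul]
    exact hone.trans (le_add_of_nonneg_right hε)
  | m + 2, hm => by
    have hm' := norm_le_of_norm_succ_add_le hδ hε h0 hadd hsub m (by omega)
    rw [← add_sub_cancel (ζ m) (ζ (m + 2))]
    refine (norm_add_le_of_le hm' (hsub m hm)).trans ?_
    push_cast
    linarith

variable [ProperSpace V]

theorem exists_norm_sub_le (hs : 1 ≤ s) (hy : SolvesODE f T y) (hf : ContDiff ℝ ∞ f)
    (hγ : IsGaussNodes γ) (hT : 0 ≤ T) (hb : HasBoundedStages γ f) :
    ∃ ρ K, (∀ t ∈ Icc 0 T, ‖y t‖ ≤ ρ) ∧ ∀ᶠ h in 𝓝[>] (0 : ℝ), ∀ n : ℕ, n * h ≤ T →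
      ∀ v Y, IsCollSeq γ f h n v Y → v 0 = y 0 →
        (∀ m ≤ n, ‖v m - y (m * h)‖ ≤ K * h ^ (2 * s)) ∧
        ∀ m < n, ∃ c : CollStep γ f y T ρ, c.IsNth h v Y m := by
  obtain ⟨ρ, hρ, hstep⟩ := hb.exists_isNth hy
  obtain ⟨C, hC0, hC⟩ := (CollStep.isBigO_nextError_sub_initError hs hy hf hγ hρ id).exists_nonneg
  rw [isBigOWith_top] at hC
  refine ⟨ρ, C * T * Real.exp (C * T), hρ, ?_⟩
  filter_upwards [hstep, self_mem_nhdsWithin, eventually_mul_le 1 one_pos,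
    eventually_mul_le (C * T * Real.exp (C * T)) one_pos]
    with h hstep (hh : 0 < h) hh1 hhK n hn v Y hseq hv0
  rw [mul_one] at hh1
  have htime : ∀ m ≤ n, (m : ℝ) * h ≤ T := fun m hm =>
    (mul_le_mul_of_nonneg_right (Nat.cast_le.mpr hm) hh.le).trans hn
  have hgrowth : ∀ m ≤ n, C * h ^ (2 * s + 1) * m * Real.exp (C * h * m) ≤
      C * T * Real.exp (C * T) * h ^ (2 * s) := fun m hm => by
    calc C * h ^ (2 * s + 1) * m * Real.exp (C * h * m)
        = C * (m * h) * Real.exp (C * (m * h)) * h ^ (2 * s) := by ring_nf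
      _ ≤ C * T * Real.exp (C * T) * h ^ (2 * s) := by gcongr <;> exact htime m hm
  have hnear : C * T * Real.exp (C * T) * h ^ (2 * s) ≤ h ^ s := by
    calc C * T * Real.exp (C * T) * h ^ (2 * s)
        ≤ C * T * Real.exp (C * T) * h ^ (s + 1) :=
          mul_le_mul_of_nonneg_left (pow_le_pow_of_le_one hh.le hh1 (by omega)) (by positivity)
      _ = h * (C * T * Real.exp (C * T)) * h ^ s := by ring
      _ ≤ h ^ s := mul_le_of_le_one_left (by positivity) hhK
  have hnth : ∀ m < n, ‖v m - y (m * h)‖ ≤ C * T * Real.exp (C * T) * h ^ (2 * s) →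
      ∃ c : CollStep γ f y T ρ, c.IsNth h v Y m := fun m hm herr =>
    hstep v Y m (htime _ hm) (herr.trans hnear) (hseq.isStages m hm)
  have herr : ∀ m ≤ n, ‖v m - y (m * h)‖ ≤ C * T * Real.exp (C * T) * h ^ (2 * s) := fun m hm => by
    refine (le_mul_exp_of_le_of_succ_le (u := fun m => ‖v m - y (m * h)‖) (α := C * h)
      (β := C * h ^ (2 * s + 1)) (by positivity) (by positivity) (by simp [hv0])
      (fun m hm hum => ?_) hm).trans (hgrowth m hm)
    obtain ⟨c, hc⟩ := hnth m hm (hum.trans (hgrowth m hm.le))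
    have hlocal := hC c
    simp only [id, hc.initError_eq, hc.nextError_eq hseq hm, hc.1] at hlocal
    rw [Real.norm_of_nonneg (by positivity)] at hlocal
    linarith [norm_le_norm_add_norm_sub' (v (m + 1) - y ((m + 1 : ℕ) * h)) (v m - y (m * h))]
  exact ⟨herr, fun m hm => hnth m hm (herr m hm.le)⟩

lemma exists_norm_extrapolationError_le (hs : 1 ≤ s) (hy : SolvesODE f T y) (hf : ContDiff ℝ ∞ f)
    (hγ : IsGaussNodes γ) (hρ : ∀ t ∈ Icc 0 T, ‖y t‖ ≤ ρ) (K : ℝ) :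
    ∃ C ≥ 0, ∀ c : CollStep γ f y T ρ, ‖c.initError‖ ≤ K * c.h ^ (2 * s) →
      ‖c.extrapolationError‖ ≤ C * c.h ^ (s + 1) := by
  let good := {c : CollStep γ f y T ρ // ‖c.initError‖ ≤ K * c.h ^ (2 * s)}
  have he : (fun c : good => c.1.initError) =O[⊤] fun c => c.1.h ^ (2 * s) :=
    isBigO_top.mpr ⟨K, fun c => by simpa [abs_of_pos c.1.h_mem.1] using c.2⟩
  obtain ⟨C, hC0, hC⟩ := (CollStep.isBigO_extrapolationError hy hf hγ hρ
    (he.trans (isBigO_pow_pow (CollStep.isBigO_h _) (by omega)))).exists_nonneg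
  refine ⟨C, hC0, fun c hc => ?_⟩
  simpa [abs_of_pos c.h_mem.1] using isBigOWith_top.mp hC ⟨c, hc⟩

lemma exists_norm_extrapolationError_sub_le (hs : 1 ≤ s) (hy : SolvesODE f T y)
    (hf : ContDiff ℝ ∞ f) (hγ : IsGaussNodes γ) (hρ : ∀ t ∈ Icc 0 T, ‖y t‖ ≤ ρ) (K : ℝ) :
    ∃ C ≥ 0, ∀ c c' : CollStep γ f y T ρ, c.IsFollowedBy c' →
      ‖c.initError‖ ≤ K * c.h ^ (2 * s) →
        ‖c'.extrapolationError - c.extrapolationError‖ ≤ C * c.h ^ (s + 2) := by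
  let good := {p : CollStep γ f y T ρ × CollStep γ f y T ρ //
    p.1.IsFollowedBy p.2 ∧ ‖p.1.initError‖ ≤ K * p.1.h ^ (2 * s)}
  have he : (fun p : good => p.1.1.initError) =O[⊤] fun p => p.1.1.h ^ (2 * s) :=
    isBigO_top.mpr ⟨K, fun p => by simpa [abs_of_pos p.1.1.h_mem.1] using p.2.2⟩
  obtain ⟨C, hC0, hC⟩ := (CollStep.isBigO_extrapolationError_sub hs hy hf hγ hρ
    (fun p : good => p.2.1)
    (he.trans (isBigO_pow_pow (CollStep.isBigO_h _) (by omega)))).exists_nonneg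
  refine ⟨C, hC0, fun c c' hcc' hc => ?_⟩
  simpa [abs_of_pos c.h_mem.1] using isBigOWith_top.mp hC ⟨(c, c'), hcc', hc⟩

theorem exists_norm_algebraic_sub_le_of_even (hs : 1 ≤ s) (hs2 : Even s) (hy : SolvesODE f T y)
    (hf : ContDiff ℝ ∞ f) (hγ : IsGaussNodes γ) (hT : 0 ≤ T) (hb : HasBoundedStages γ f)
    (P : V →L[ℝ] Z) :
    ∃ C, ∀ᶠ h in 𝓝[>] (0 : ℝ), ∀ n : ℕ, n * h ≤ T → ∀ v Y z, IsCollSeq γ f h n v Y →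
      IsAlgebraicSeq γ f P n Y z → v 0 = y 0 → z 0 = P (f (y 0)) →
        ‖z n - P (f (y (n * h)))‖ ≤ C * h ^ s := by
  obtain ⟨ρ, K, hρ, hsteps⟩ := exists_norm_sub_le hs hy hf hγ hT hb
  obtain ⟨C, hC0, hC⟩ := exists_norm_extrapolationError_le hs hy hf hγ hρ K
  refine ⟨‖P‖ * C * T, ?_⟩
  filter_upwards [hsteps, self_mem_nhdsWithin]
    with h hsteps (hh : 0 < h) n hn v Y z hseq hz hv0 hz0
  obtain ⟨herr, hnth⟩ := hsteps n hn v Y hseq hv0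
  let ζ := fun m : ℕ => z m - P (f (y (m * h)))
  have hζ0 : ζ 0 = 0 := by simp [ζ, hz0]
  have hstep : ∀ {m}, m < n → dist (ζ m) (ζ (m + 1)) ≤ ‖P‖ * (C * h ^ (s + 1)) := fun {m} hm => by
    obtain ⟨c, hc⟩ := hnth m hm
    have hζ : ζ (m + 1) = ζ m + P c.extrapolationError :=
      (hz.error_succ hm hc).trans (by rw [hs2.neg_one_pow, one_smul])
    rw [hζ, dist_self_add_right, ← hc.1]
    exact P.le_opNorm_of_le (hC c (by rw [hc.initError_eq, hc.1]; exact herr m hm.le))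
  calc ‖ζ n‖ = dist (ζ 0) (ζ n) := by rw [hζ0, dist_zero_left]
    _ ≤ ∑ _m ∈ Finset.range n, ‖P‖ * (C * h ^ (s + 1)) := dist_le_range_sum_of_dist_le n hstep
    _ = ‖P‖ * C * (n * h) * h ^ s := by
      rw [Finset.sum_const, Finset.card_range, nsmul_eq_mul]
      ring
    _ ≤ ‖P‖ * C * T * h ^ s := by gcongr

/-- For odd `s` the recursion for the error is `ζ (m + 1) = -ζ m + d m`, so that two steps add only
`d (m + 1) - d m`, which is one order smaller than `d m`. -/
theorem exists_norm_algebraic_sub_le_of_odd (hs : 1 ≤ s) (hs2 : Odd s) (hy : SolvesODE f T y)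
    (hf : ContDiff ℝ ∞ f) (hγ : IsGaussNodes γ) (hT : 0 ≤ T) (hb : HasBoundedStages γ f)
    (P : V →L[ℝ] Z) :
    ∃ C, ∀ᶠ h in 𝓝[>] (0 : ℝ), ∀ n : ℕ, n * h ≤ T → ∀ v Y z, IsCollSeq γ f h n v Y →
      IsAlgebraicSeq γ f P n Y z → v 0 = y 0 → z 0 = P (f (y 0)) →
        ‖z n - P (f (y (n * h)))‖ ≤ C * h ^ (s + 1) := by
  obtain ⟨ρ, K, hρ, hsteps⟩ := exists_norm_sub_le hs hy hf hγ hT hb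
  obtain ⟨C, hC0, hC⟩ := exists_norm_extrapolationError_le hs hy hf hγ hρ K
  obtain ⟨B, hB0, hB⟩ := exists_norm_extrapolationError_sub_le hs hy hf hγ hρ K
  refine ⟨‖P‖ * C + ‖P‖ * B * T, ?_⟩
  filter_upwards [hsteps, self_mem_nhdsWithin]
    with h hsteps (hh : 0 < h) n hn v Y z hseq hz hv0 hz0
  obtain ⟨herr, hnth⟩ := hsteps n hn v Y hseq hv0
  let ζ := fun m : ℕ => z m - P (f (y (m * h)))
  have hζ : ∀ {c : CollStep γ f y T ρ} {m}, m < n → c.IsNth h v Y m →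
      ζ (m + 1) = -ζ m + P c.extrapolationError := fun hm hc =>
    (hz.error_succ hm hc).trans (by rw [hs2.neg_one_pow, neg_one_smul])
  have hinit : ∀ {c : CollStep γ f y T ρ} {m}, m < n → c.IsNth h v Y m →
      ‖c.initError‖ ≤ K * c.h ^ (2 * s) := fun {c m} hm hc => by
    rw [hc.initError_eq, hc.1]
    exact herr m hm.le
  have hadd : ∀ m < n, ‖ζ (m + 1) + ζ m‖ ≤ ‖P‖ * (C * h ^ (s + 1)) := fun m hm => by
    obtain ⟨c, hc⟩ := hnth m hm
    rw [hζ hm hc, neg_add_cancel_comm, ← hc.1]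
    exact P.le_opNorm_of_le (hC c (hinit hm hc))
  have hsub : ∀ m, m + 1 < n → ‖ζ (m + 2) - ζ m‖ ≤ ‖P‖ * (B * h ^ (s + 2)) := fun m hm => by
    have hmn : m < n := by omega
    obtain ⟨c, hc⟩ := hnth m hmn
    obtain ⟨c', hc'⟩ := hnth (m + 1) hm
    have htwo : ζ (m + 2) - ζ m = P (c'.extrapolationError - c.extrapolationError) := by
      rw [hζ hm hc', hζ hmn hc, map_sub]
      abel
    rw [htwo, ← hc.1]
    exact P.le_opNorm_of_le (hB c c' (hc.isFollowedBy hseq hc' hmn) (hinit hmn hc))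
  calc ‖ζ n‖ ≤ ‖P‖ * (C * h ^ (s + 1)) + n * (‖P‖ * (B * h ^ (s + 2))) :=
        norm_le_of_norm_succ_add_le (by positivity) (by positivity) (by simp [ζ, hz0]) hadd hsub
          n le_rfl
    _ = (‖P‖ * C + ‖P‖ * B * (n * h)) * h ^ (s + 1) := by ring
    _ ≤ (‖P‖ * C + ‖P‖ * B * T) * h ^ (s + 1) := by gcongr

end Convergence

section Blocks

variable (p : Params) (E : Matrix (Fin 6) (Fin 6) ℝ)

lemma col_inj {a a' b b' : Fin 4 → ℝ} {c c' d d' : Fin 6 → ℝ} {e e' : ℝ} :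
    col a b c d e = col a' b' c' d' e' ↔ a = a' ∧ b = b' ∧ c = c' ∧ d = d' ∧ e = e' := by
  refine ⟨fun h => ⟨funext fun i => congrFun h (.inl (.inl i)),
    funext fun i => congrFun h (.inl (.inr i)), funext fun i => congrFun h (.inr (.inl (.inl i))),
    funext fun i => congrFun h (.inr (.inl (.inr i))), congrFun h (.inr (.inr ()))⟩, ?_⟩
  rintro ⟨rfl, rfl, rfl, rfl, rfl⟩
  rfl

lemma col_blocks (x : State) : col x.dPsi x.Psi x.dTheta x.Theta x.time = x := by
  funext i
  rcases i with (i | i) | ((i | i) | i) <;> rfl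

lemma mM_mulVec (a b : Fin 4 → ℝ) (c d : Fin 6 → ℝ) (e : ℝ) :
    mM p E *ᵥ col a b c d e = col 0 (p.KL *ᵥ b) (p.J *ᵥ c) (E *ᵥ d) e := by
  simp only [mM, col, Matrix.fromBlocks_mulVec, Sum.elim_comp_inl, Sum.elim_comp_inr,
    Matrix.zero_mulVec, zero_add, add_zero, Matrix.one_mulVec]

lemma mP_sub_mQ_mulVec (a b : Fin 4 → ℝ) (c d : Fin 6 → ℝ) (e : ℝ) :
    (mP p E - mQ p) *ᵥ col a b c d e =
      col (-(p.KR *ᵥ a) - p.KL *ᵥ b) (p.KL *ᵥ a) (-(p.D *ᵥ c) - E *ᵥ d) (E *ᵥ c) 0 := by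
  rw [Matrix.sub_mulVec]
  simp only [mP, mQ, col, Matrix.fromBlocks_mulVec, Sum.elim_comp_inl, Sum.elim_comp_inr,
    Matrix.zero_mulVec, zero_add, add_zero, Matrix.neg_mulVec]
  funext i
  rcases i with (i | i) | ((i | i) | i) <;> simp <;> ring

lemma mN_sub_mV_mulVec (a b : Fin 4 → ℝ) (c d : Fin 6 → ℝ) (e : ℝ) :
    (mN - mV) *ᵥ col a b c d e = col a 0 c 0 e := by
  simp only [mN, mV, sub_zero, col, Matrix.fromBlocks_mulVec, Sum.elim_comp_inl,
    Sum.elim_comp_inr, Matrix.zero_mulVec, zero_add, add_zero, Matrix.one_mulVec]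

/-- The blocks of the coefficient matrices that have to be inverted in order to solve the descriptor
system for the derivatives of `(Ψ̃, dθ/dt, θ)` and for `dΨ̃/dt` are invertible. -/
structure HasInvertibleBlocks : Prop where
  KL : IsUnit p.KL.det
  KR : IsUnit p.KR.det
  J : IsUnit p.J.det
  E : IsUnit E.det

variable {p E}

lemma Params.Admissible.hasInvertibleBlocks (hp : p.Admissible) (hE : IsUnit E.det) :
    HasInvertibleBlocks p E where
  KL := by
    rw [isUnit_iff_ne_zero, Params.KL, Matrix.det_smul, Matrix.det_diagonal]
    simp [Fin.prod_univ_succ, hp.Δ_ne, hp.Lr_ne, hp.sum_ne, -neg_add_rev]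
  KR := by
    rw [isUnit_iff_ne_zero, Params.KR, Matrix.det_diagonal]
    simp [Fin.prod_univ_succ, hp.R_ne, hp.Rf_ne, hp.Rq_ne]
  J := by
    rw [isUnit_iff_ne_zero, Params.J, Matrix.det_diagonal]
    exact Finset.prod_ne_zero_iff.mpr fun i _ => hp.inertia_ne i
  E := hE

lemma rhs_eq (hpE : HasInvertibleBlocks p E) (x : State) :
    rhs p E x = col (p.Is x.time - p.KR *ᵥ x.dPsi - (p.KL + p.Γ (x.Theta 4)) *ᵥ x.Psi)
      (p.KL *ᵥ x.dPsi)
      (p.T - p.D *ᵥ x.dTheta - (p.K *ᵥ x.Theta + (1 / 2 : ℝ) • p.torqueForm x.Psi x.Theta))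
      (E *ᵥ x.dTheta) 1 := by
  rw [rhs, z, u, mP_sub_mQ_mulVec, mN_sub_mV_mulVec, Matrix.mulVec_mulVec _ p.KL,
    Matrix.mul_nonsing_inv _ hpE.KL, Matrix.one_mulVec, Matrix.mulVec_mulVec _ E,
    Matrix.mul_nonsing_inv _ hpE.E, Matrix.one_mulVec]
  funext i
  rcases i with (i | i) | ((i | i) | i) <;> simp [col] <;> ring

end Blocks

section Reduction

/-- The space of the differential variables `(Ψ̃, dθ/dt, θ, t)`. -/
abbrev Reduced : Type := (Fin 4 → ℝ) × (Fin 6 → ℝ) × (Fin 6 → ℝ) × ℝ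

/-- The differential variables of a state. -/
def reduce : State →ₗ[ℝ] Reduced where
  toFun x := (x.Psi, x.dTheta, x.Theta, x.time)
  map_add' _ _ := rfl
  map_smul' _ _ := rfl

/-- The algebraic variables `dΨ̃/dt` of a state. -/
def algebraicPart : State →ₗ[ℝ] (Fin 4 → ℝ) where
  toFun x := x.dPsi
  map_add' _ _ := rfl
  map_smul' _ _ := rfl

/-- The vector field of the ordinary differential equation that the differential variables of a
solution satisfy. It is obtained by inverting the blocks of `HasInvertibleBlocks`; its first
component is also the value of `dΨ̃/dt` given by the algebraic equation. -/
def field (p : Params) (v : Reduced) : Reduced :=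
  (p.KR⁻¹ *ᵥ (p.Is v.2.2.2 - (p.KL + p.Γ (v.2.2.1 4)) *ᵥ v.1),
    p.J⁻¹ *ᵥ (p.T - p.D *ᵥ v.2.1 -
      (p.K *ᵥ v.2.2.1 + (1 / 2 : ℝ) • p.torqueForm v.1 v.2.2.1)),
    v.2.1, 1)

lemma norm_Psi_le (x : State) : ‖x.Psi‖ ≤ ‖reduce x‖ := norm_fst_le (reduce x)

lemma norm_dTheta_le (x : State) : ‖x.dTheta‖ ≤ ‖reduce x‖ :=
  (norm_fst_le (reduce x).2).trans (norm_snd_le _)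

lemma norm_Theta_le (x : State) : ‖x.Theta‖ ≤ ‖reduce x‖ :=
  (norm_fst_le (reduce x).2.2).trans ((norm_snd_le (reduce x).2).trans (norm_snd_le _))

variable {p : Params} {E : Matrix (Fin 6) (Fin 6) ℝ}

lemma mulVec_eq_iff_eq_nonsing_inv_mulVec {n : Type*} [Fintype n] [DecidableEq n]
    {A : Matrix n n ℝ} (hA : IsUnit A.det) {x b : n → ℝ} : A *ᵥ x = b ↔ x = A⁻¹ *ᵥ b := by
  constructor
  · rintro rfl
    rw [Matrix.mulVec_mulVec, Matrix.nonsing_inv_mul _ hA, Matrix.one_mulVec]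
  · rintro rfl
    rw [Matrix.mulVec_mulVec, Matrix.mul_nonsing_inv _ hA, Matrix.one_mulVec]

lemma mM_mulVec_eq_rhs_iff (hpE : HasInvertibleBlocks p E) (k x : State) :
    mM p E *ᵥ k = rhs p E x ↔
      algebraicPart x = (field p (reduce x)).1 ∧ reduce k = field p (reduce x) := by
  have halg : 0 = p.Is x.time - p.KR *ᵥ x.dPsi - (p.KL + p.Γ (x.Theta 4)) *ᵥ x.Psi ↔
      x.dPsi = (field p (reduce x)).1 := by
    rw [eq_comm, sub_right_comm, sub_eq_zero, eq_comm,
      mulVec_eq_iff_eq_nonsing_inv_mulVec hpE.KR]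
    rfl
  rw [rhs_eq hpE, ← col_blocks k, mM_mulVec, col_inj, halg, col_blocks k,
    mulVec_eq_iff_eq_nonsing_inv_mulVec hpE.J, mulVec_eq_iff_eq_nonsing_inv_mulVec hpE.KL,
    mulVec_eq_iff_eq_nonsing_inv_mulVec hpE.E, Matrix.mulVec_mulVec, Matrix.mulVec_mulVec,
    Matrix.nonsing_inv_mul _ hpE.KL, Matrix.nonsing_inv_mul _ hpE.E, Matrix.one_mulVec,
    Matrix.one_mulVec]
  refine and_congr_right fun hx => ?_
  rw [Prod.ext_iff, Prod.ext_iff, Prod.ext_iff, ← hx]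
  exact Iff.rfl

end Reduction

section Smooth

variable (p : Params)

lemma contDiff_mulVec {X : Type*} [NormedAddCommGroup X] [NormedSpace ℝ X] {m n : Type*}
    [Fintype m] [Fintype n] {A : X → Matrix m n ℝ} {g : X → n → ℝ}
    (hA : ∀ i j, ContDiff ℝ ∞ fun x => A x i j) (hg : ContDiff ℝ ∞ g) :
    ContDiff ℝ ∞ fun x => A x *ᵥ g x :=
  contDiff_pi.mpr fun i => ContDiff.sum fun j _ => (hA i j).mul (contDiff_pi.mp hg j)

lemma contDiff_Γ (i j : Fin 4) : ContDiff ℝ ∞ fun φ => p.Γ φ i j := by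
  refine contDiff_const.mul ?_
  fin_cases i <;> fin_cases j <;> first
    | exact contDiff_const
    | exact Real.contDiff_cos
    | exact Real.contDiff_sin
    | exact Real.contDiff_sin.neg

lemma contDiff_dΓ (i j : Fin 4) : ContDiff ℝ ∞ fun φ => p.dΓ φ i j :=
  (contDiff_infty_iff_deriv.mp (contDiff_Γ p i j)).2

lemma contDiff_Is : ContDiff ℝ ∞ p.Is := by
  have hphase : ContDiff ℝ ∞ fun t => p.ωs * t := contDiff_const.mul contDiff_id
  refine contDiff_pi.mpr fun i => ?_
  fin_cases i
  exacts [contDiff_const.mul hphase.cos, contDiff_const.mul hphase.sin, contDiff_const,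
    contDiff_const]

lemma contDiff_torqueForm :
    ContDiff ℝ ∞ fun q : (Fin 4 → ℝ) × (Fin 6 → ℝ) => p.torqueForm q.1 q.2 := by
  have hφ : ContDiff ℝ ∞ fun q : (Fin 4 → ℝ) × (Fin 6 → ℝ) => q.2 4 := by fun_prop
  have hmul : ContDiff ℝ ∞ fun q : (Fin 4 → ℝ) × (Fin 6 → ℝ) => p.dΓ (q.2 4) *ᵥ q.1 :=
    contDiff_mulVec (fun i j => (contDiff_dΓ p i j).comp hφ) contDiff_fst
  have hdot : ContDiff ℝ ∞ fun q : (Fin 4 → ℝ) × (Fin 6 → ℝ) => q.1 ⬝ᵥ (p.dΓ (q.2 4) *ᵥ q.1) :=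
    ContDiff.sum fun j _ => ContDiff.mul (by fun_prop) (contDiff_pi.mp hmul j)
  refine contDiff_pi.mpr fun i => ?_
  fin_cases i <;> first | exact hdot | exact contDiff_const

lemma contDiff_field : ContDiff ℝ ∞ (field p) := by
  have hφ : ContDiff ℝ ∞ fun v : Reduced => v.2.2.1 4 := by fun_prop
  have hconst : ∀ {k : ℕ} (A : Matrix (Fin k) (Fin k) ℝ) {g : Reduced → Fin k → ℝ},
      ContDiff ℝ ∞ g → ContDiff ℝ ∞ fun v => A *ᵥ g v := fun A _ hg =>
    contDiff_mulVec (fun _ _ => contDiff_const) hg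
  have hcurrent : ContDiff ℝ ∞ fun v : Reduced => p.Is v.2.2.2 := (contDiff_Is p).comp (by fun_prop)
  have hflux : ContDiff ℝ ∞ fun v : Reduced => (p.KL + p.Γ (v.2.2.1 4)) *ᵥ v.1 :=
    contDiff_mulVec (fun i j => contDiff_const.add ((contDiff_Γ p i j).comp hφ)) contDiff_fst
  have htorque : ContDiff ℝ ∞ fun v : Reduced => p.torqueForm v.1 v.2.2.1 :=
    ContDiff.comp (f := fun v : Reduced => (v.1, v.2.2.1)) (contDiff_torqueForm p) (by fun_prop)
  have hforce : ContDiff ℝ ∞ fun v : Reduced => p.T - p.D *ᵥ v.2.1 -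
      (p.K *ᵥ v.2.2.1 + (1 / 2 : ℝ) • p.torqueForm v.1 v.2.2.1) :=
    (contDiff_const.sub (hconst _ (by fun_prop))).sub
      ((hconst _ (by fun_prop)).add (htorque.const_smul _))
  exact (hconst _ (hcurrent.sub hflux)).prodMk ((hconst _ hforce).prodMk (by fun_prop))

end Smooth

section Growth

variable (p : Params)

lemma isBigO_mulVec {ι m n : Type*} [Fintype m] [Fintype n] {l : Filter ι} {A : ι → Matrix m n ℝ}
    {x : ι → n → ℝ} {g : ι → ℝ} (hA : ∀ i j, (fun a => A a i j) =O[l] fun _ => (1 : ℝ))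
    (hx : x =O[l] g) : (fun a => A a *ᵥ x a) =O[l] g :=
  isBigO_pi.mpr fun i => IsBigO.fun_sum fun j _ => by
    simpa only [one_mul] using (hA i j).mul (isBigO_pi.mp hx j)

lemma isBigO_const_mulVec {ι m n : Type*} [Fintype m] [Fintype n] {l : Filter ι} (A : Matrix m n ℝ)
    {x : ι → n → ℝ} {g : ι → ℝ} (hx : x =O[l] g) : (fun a => A *ᵥ x a) =O[l] g :=
  isBigO_mulVec (fun i j => isBigO_const_const (A i j) one_ne_zero l) hx

lemma isBigO_Γ (i j : Fin 4) : (fun φ => p.Γ φ i j) =O[⊤] fun _ => (1 : ℝ) := by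
  refine IsBigO.const_mul_left (isBigO_of_le _ fun φ => ?_) _
  fin_cases i <;> fin_cases j <;> simp [Real.abs_cos_le_one, Real.abs_sin_le_one]

lemma isBigO_dΓ (i j : Fin 4) : (fun φ => p.dΓ φ i j) =O[⊤] fun _ => (1 : ℝ) := by
  simp only [Params.dΓ, Matrix.of_apply, Params.Γ, Matrix.smul_apply, smul_eq_mul,
    deriv_const_mul_field]
  refine IsBigO.const_mul_left (isBigO_of_le _ fun φ => ?_) _
  fin_cases i <;> fin_cases j <;> simp [Real.abs_cos_le_one, Real.abs_sin_le_one]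

lemma isBigO_Is : p.Is =O[⊤] fun _ => (1 : ℝ) := by
  have hcos : (fun t => Real.cos (p.ωs * t)) =O[⊤] fun _ => (1 : ℝ) :=
    isBigO_of_le _ fun t => by simpa using Real.abs_cos_le_one _
  have hsin : (fun t => Real.sin (p.ωs * t)) =O[⊤] fun _ => (1 : ℝ) :=
    isBigO_of_le _ fun t => by simpa using Real.abs_sin_le_one _
  refine isBigO_pi.mpr fun i => ?_
  fin_cases i
  exacts [hcos.const_mul_left _, hsin.const_mul_left _, isBigO_const_const _ one_ne_zero _,
    isBigO_zero _ _]

lemma isBigO_torqueForm : (fun q : (Fin 4 → ℝ) × (Fin 6 → ℝ) => p.torqueForm q.1 q.2) =O[⊤]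
    fun q => ‖q.1‖ ^ 2 := by
  have hfst : (fun q : (Fin 4 → ℝ) × (Fin 6 → ℝ) => q.1) =O[⊤] fun q => ‖q.1‖ :=
    (isBigO_refl _ _).norm_right
  have hmul : (fun q : (Fin 4 → ℝ) × (Fin 6 → ℝ) => p.dΓ (q.2 4) *ᵥ q.1) =O[⊤] fun q => ‖q.1‖ :=
    isBigO_mulVec (fun i j => (isBigO_dΓ p i j).comp_tendsto tendsto_top) hfst
  have hdot : (fun q : (Fin 4 → ℝ) × (Fin 6 → ℝ) => q.1 ⬝ᵥ (p.dΓ (q.2 4) *ᵥ q.1)) =O[⊤]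
      fun q => ‖q.1‖ ^ 2 := IsBigO.fun_sum fun j _ => by
    simpa only [sq] using (isBigO_pi.mp hfst j).mul (isBigO_pi.mp hmul j)
  refine isBigO_pi.mpr fun i => ?_
  fin_cases i <;> first | exact hdot | exact isBigO_zero _ _

lemma isBigO_field_fst : (fun v => (field p v).1) =O[⊤] fun v => 1 + ‖v.1‖ := by
  have hone : (fun _ : Reduced => (1 : ℝ)) =O[⊤] fun v => 1 + ‖v.1‖ :=
    isBigO_left_add (fun _ => zero_le_one) fun v => norm_nonneg v.1
  have hfst : (fun v : Reduced => v.1) =O[⊤] fun v => 1 + ‖v.1‖ :=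
    (isBigO_right_add (fun _ : Reduced => zero_le_one) fun v => norm_nonneg v.1).of_norm_left
  have hflux : (fun v : Reduced => (p.KL + p.Γ (v.2.2.1 4)) *ᵥ v.1) =O[⊤] fun v => 1 + ‖v.1‖ :=
    isBigO_mulVec (fun i j => (isBigO_const_const (p.KL i j) one_ne_zero _).add
      ((isBigO_Γ p i j).comp_tendsto tendsto_top)) hfst
  exact isBigO_const_mulVec _ ((((isBigO_Is p).comp_tendsto tendsto_top).trans hone).sub hflux)

/-- Since the torque is quadratic in `Ψ̃`, the growth is linear only as long as `Ψ̃` is bounded. -/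
lemma isBigO_field (r : ℝ) :
    (fun v : {v : Reduced // ‖v.1‖ ≤ r} => field p v) =O[⊤] fun v => 1 + ‖v.1‖ := by
  have hone : (fun _ : {v : Reduced // ‖v.1‖ ≤ r} => (1 : ℝ)) =O[⊤] fun v => 1 + ‖v.1‖ :=
    isBigO_left_add (fun _ => zero_le_one) fun v => norm_nonneg v.1
  have hid : (fun v : {v : Reduced // ‖v.1‖ ≤ r} => v.1) =O[⊤] fun v => 1 + ‖v.1‖ :=
    (isBigO_right_add (fun _ : {v : Reduced // ‖v.1‖ ≤ r} => zero_le_one)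
      fun v => norm_nonneg v.1).of_norm_left
  obtain ⟨hΨ, hrest⟩ := isBigO_prod_left.mp hid
  obtain ⟨hω, hθt⟩ := isBigO_prod_left.mp hrest
  have hθ := (isBigO_prod_left.mp hθt).1
  have hfst : (fun v : {v : Reduced // ‖v.1‖ ≤ r} => (field p v).1) =O[⊤] fun v => 1 + ‖v.1‖ :=
    ((isBigO_field_fst p).comp_tendsto tendsto_top).trans (hone.add hΨ.norm_left)
  have htorque : (fun v : {v : Reduced // ‖v.1‖ ≤ r} => p.torqueForm v.1.1 v.1.2.2.1) =O[⊤]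
      fun v => 1 + ‖v.1‖ := by
    have hsq : (fun v : {v : Reduced // ‖v.1‖ ≤ r} => ‖v.1.1‖ ^ 2) =O[⊤] fun _ => (1 : ℝ) :=
      isBigO_top.mpr ⟨r ^ 2, fun v => by
        simpa using pow_le_pow_left₀ (norm_nonneg _) v.2 2⟩
    exact (((isBigO_torqueForm p).comp_tendsto (k := fun v : {v : Reduced // ‖v.1‖ ≤ r} =>
      (v.1.1, v.1.2.2.1)) tendsto_top).trans hsq).trans hone
  have hT : (fun _ : {v : Reduced // ‖v.1‖ ≤ r} => p.T) =O[⊤] fun v => 1 + ‖v.1‖ :=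
    (isBigO_const_const _ one_ne_zero _).trans hone
  have hforce : (fun v : {v : Reduced // ‖v.1‖ ≤ r} => p.T - p.D *ᵥ v.1.2.1 -
      (p.K *ᵥ v.1.2.2.1 + (1 / 2 : ℝ) • p.torqueForm v.1.1 v.1.2.2.1)) =O[⊤]
      fun v => 1 + ‖v.1‖ :=
    (hT.sub (isBigO_const_mulVec _ hω)).sub
      ((isBigO_const_mulVec _ hθ).add (htorque.const_smul_left (1 / 2 : ℝ)))
  exact hfst.prod_left ((isBigO_const_mulVec _ hforce).prod_left (hω.prod_left hone))

end Growth

section Apriori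

variable {s : ℕ} {V W : Type*} [NormedAddCommGroup V] [NormedSpace ℝ V] [NormedAddCommGroup W]
  [NormedSpace ℝ W] {γ : Fin s → ℝ} {f : V → V}

lemma norm_stage_le {C h : ℝ} (hC : 0 ≤ C) (hh : 0 ≤ h)
    (hsmall : ∀ i, h * ((∑ j, |collA γ i j|) * C) ≤ 1 / 2) {v : V} {Y k : Fin s → V}
    (hk : ∀ i, ‖k i‖ ≤ C * (1 + ‖Y i‖)) (hY : ∀ i, Y i = v + h • ∑ j, collA γ i j • k j)
    (i : Fin s) : ‖Y i‖ ≤ 2 * ‖v‖ + 1 := by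
  have hstage : ∀ i, ‖Y i‖ ≤ ‖v‖ + 1 / 2 * (1 + ‖Y‖) := fun i => by
    have hsum : ‖∑ j, collA γ i j • k j‖ ≤ ∑ j, |collA γ i j| * (C * (1 + ‖Y‖)) :=
      norm_sum_le_of_le _ fun j _ => by
        rw [norm_smul, Real.norm_eq_abs]
        gcongr
        exact (hk j).trans (by gcongr; exact norm_le_pi_norm Y j)
    rw [hY i]
    refine norm_add_le_of_le le_rfl ?_
    calc ‖h • ∑ j, collA γ i j • k j‖ ≤ h * ∑ j, |collA γ i j| * (C * (1 + ‖Y‖)) := by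
          rw [norm_smul, Real.norm_of_nonneg hh]
          gcongr
      _ = h * ((∑ j, |collA γ i j|) * C) * (1 + ‖Y‖) := by rw [← Finset.sum_mul]; ring
      _ ≤ 1 / 2 * (1 + ‖Y‖) := by gcongr; exact hsmall i
  have hnorm : ‖Y‖ ≤ ‖v‖ + 1 / 2 * (1 + ‖Y‖) :=
    (pi_norm_le_iff_of_nonneg (by positivity)).mpr hstage
  exact (norm_le_pi_norm Y i).trans (by linarith)

lemma eventually_mul_sum_collA_le (γ : Fin s → ℝ) (C : ℝ) :
    ∀ᶠ h in 𝓝[>] (0 : ℝ), ∀ i, h * ((∑ j, |collA γ i j|) * C) ≤ 1 / 2 :=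
  eventually_all.mpr fun _ => eventually_mul_le _ one_half_pos

lemma HasBoundedStages.of_isBigO (P : V →L[ℝ] W)
    (hP : (fun v => P (f v)) =O[⊤] fun v => 1 + ‖P v‖)
    (hf : ∀ r, (fun v : {v // ‖P v‖ ≤ r} => f v) =O[⊤] fun v => 1 + ‖v.1‖) :
    HasBoundedStages γ f := by
  intro ρ
  obtain ⟨B, hB0, hB⟩ := hP.exists_nonneg
  obtain ⟨C, hC0, hC⟩ := (hf (2 * (‖P‖ * ρ) + 1)).exists_nonneg
  rw [isBigOWith_top] at hB hC
  refine ⟨2 * ρ + 1, ?_⟩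
  filter_upwards [eventually_mul_sum_collA_le γ B, eventually_mul_sum_collA_le γ C,
    self_mem_nhdsWithin] with h hhB hhC (hh : 0 < h) v Y hv hY i
  have hPY : ∀ i, ‖P (Y i)‖ ≤ 2 * (‖P‖ * ρ) + 1 := fun i => by
    have hbound := norm_stage_le hB0 hh.le hhB (v := P v) (Y := fun i => P (Y i))
      (k := fun i => P (f (Y i)))
      (fun i => (hB (Y i)).trans_eq (by rw [Real.norm_of_nonneg (by positivity)]))
      (fun i => by rw [hY i]; simp only [map_add, map_smul, map_sum]) i
    linarith [P.le_opNorm_of_le hv]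
  have hbound := norm_stage_le hC0 hh.le hhC (v := v) (Y := Y) (k := fun i => f (Y i))
    (fun i => (hC ⟨Y i, hPY i⟩).trans_eq (by rw [Real.norm_of_nonneg (by positivity)])) hY i
  linarith

lemma hasBoundedStages_field (p : Params) (γ : Fin s → ℝ) : HasBoundedStages γ (field p) :=
  .of_isBigO (.fst ℝ _ _) (isBigO_field_fst p) (isBigO_field p)

end Apriori

section Method

variable {p : Params} {E : Matrix (Fin 6) (Fin 6) ℝ} {Tm : ℝ} {X : ℝ → State}

lemma IsSolution.solvesODE (hpE : HasInvertibleBlocks p E) (hX : IsSolution p E Tm X) :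
    SolvesODE (field p) Tm fun t => reduce (X t) := by
  intro t ht
  obtain ⟨v, hv, hMv⟩ := hX t ht
  rw [← ((mM_mulVec_eq_rhs_iff hpE _ _).mp hMv).2]
  exact (LinearMap.toContinuousLinearMap reduce).hasFDerivAt.comp_hasDerivWithinAt t hv

lemma IsSolution.algebraicPart_eq (hpE : HasInvertibleBlocks p E) (hX : IsSolution p E Tm X)
    {t : ℝ} (ht : t ∈ Icc 0 Tm) : algebraicPart (X t) = (field p (reduce (X t))).1 := by
  obtain ⟨v, -, hMv⟩ := hX t ht
  exact ((mM_mulVec_eq_rhs_iff hpE _ _).mp hMv).1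

variable {s : ℕ} {γ : Fin s → ℝ}

lemma IsGaussNodes.smul_add_sum_extrapolationWeights_smul {V : Type*} [AddCommGroup V]
    [Module ℝ V] (hγ : IsGaussNodes γ) (h : ℝ) (v : V) (k : Fin s → V) :
    (-1 : ℝ) ^ s • v + ∑ i, extrapolationWeights γ i • (v + h • ∑ j, collA γ i j • k j) =
      v + h • ∑ j, collB γ j • k j := by
  have hswap : ∑ i, extrapolationWeights γ i • ∑ j, collA γ i j • k j = ∑ j, collB γ j • k j := by
    simp only [Finset.smul_sum, smul_smul, ← hγ.sum_extrapolationWeights_mul_collA,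
      Finset.sum_smul]
    exact Finset.sum_comm
  simp only [smul_add, Finset.sum_add_distrib, ← Finset.sum_smul, smul_comm _ h,
    ← Finset.smul_sum, hswap]
  rw [← add_assoc, ← add_smul, ← hγ.one_sub_sum_extrapolationWeights, sub_add_cancel, one_smul]

lemma IsStep.exists_isStages (hpE : HasInvertibleBlocks p E) (hγ : IsGaussNodes γ) {h : ℝ}
    {x x' : State} (hx : IsStep γ p E h x x') :
    ∃ Y, IsStages γ (field p) h (reduce x) Y ∧ reduce x' = collNext γ (field p) h (reduce x) Y ∧
      algebraicPart x' =
        (-1 : ℝ) ^ s • algebraicPart x + ∑ i, extrapolationWeights γ i • (field p (Y i)).1 := by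
  obtain ⟨k, hk, rfl⟩ := hx
  have hstage := fun i => (mM_mulVec_eq_rhs_iff hpE _ _).mp (hk i)
  refine ⟨fun i => reduce (x + h • ∑ j, collA γ i j • k j), fun i => ?_, ?_, ?_⟩
  · simp only [← (hstage _).2]
    simp only [map_add, map_smul, map_sum]
  · simp only [collNext, ← (hstage _).2]
    simp only [map_add, map_smul, map_sum]
  · simp only [← (hstage _).1]
    simp only [map_add, map_smul, map_sum, hγ.smul_add_sum_extrapolationWeights_smul]

lemma exists_isStep (hpE : HasInvertibleBlocks p E) (hγ : IsGaussNodes γ) {h : ℝ} (hh : h ≠ 0)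
    {x : State} {Y : Fin s → Reduced} (hY : IsStages γ (field p) h (reduce x) Y) :
    ∃ x', IsStep γ p E h x x' := by
  obtain ⟨κ, hκ⟩ := exists_sum_collA_smul_eq hγ.1 hγ.ne_zero
    fun i => h⁻¹ • ((field p (Y i)).1 - algebraicPart x)
  let k : Fin s → State := fun j => col (κ j) (field p (Y j)).1 (field p (Y j)).2.1
    (field p (Y j)).2.2.1 (field p (Y j)).2.2.2
  have hreduce : ∀ j, reduce (k j) = field p (Y j) := fun _ => rfl
  have halg : ∀ j, algebraicPart (k j) = κ j := fun _ => rfl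
  have hstage : ∀ i, reduce (x + h • ∑ j, collA γ i j • k j) = Y i := fun i => by
    rw [hY i]
    simp only [map_add, map_smul, map_sum, hreduce]
  refine ⟨_, k, fun i => (mM_mulVec_eq_rhs_iff hpE _ _).mpr ?_, rfl⟩
  rw [hstage i]
  refine ⟨?_, rfl⟩
  simp only [map_add, map_smul, map_sum, halg, hκ i]
  rw [smul_inv_smul₀ hh, add_sub_cancel]

lemma IsNumericalSolution.exists_isCollSeq (hpE : HasInvertibleBlocks p E) (hγ : IsGaussNodes γ)
    {h : ℝ} {x0 : State} {n : ℕ} {xs : ℕ → State} (hxs : IsNumericalSolution γ p E h x0 n xs) :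
    ∃ Y, IsCollSeq γ (field p) h n (fun m => reduce (xs m)) Y ∧
      IsAlgebraicSeq γ (field p) (ContinuousLinearMap.fst ℝ _ _) n Y
        fun m => algebraicPart (xs m) := by
  choose! Y hstages hnext halg using fun m hm => (hxs.2 m hm).exists_isStages hpE hγ
  exact ⟨Y, ⟨hstages, hnext⟩, halg⟩

lemma exists_isNumericalSolution {h : ℝ} {x0 : State} {n : ℕ}
    (hstep : ∀ m < n, ∀ xs, IsNumericalSolution γ p E h x0 m xs →
      ∃ x', IsStep γ p E h (xs m) x') : ∃ xs, IsNumericalSolution γ p E h x0 n xs := by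
  induction n with
  | zero => exact ⟨fun _ => x0, rfl, fun m hm => absurd hm m.not_lt_zero⟩
  | succ n ih =>
    obtain ⟨xs, hxs⟩ := ih fun m hm => hstep m (hm.trans n.lt_succ_self)
    obtain ⟨x', hx'⟩ := hstep n n.lt_succ_self xs hxs
    refine ⟨fun m => if m ≤ n then xs m else x', by simpa using hxs.1, fun m hm => ?_⟩
    rcases Nat.lt_succ_iff_lt_or_eq.mp hm with hlt | rfl
    · simpa [hlt.le, Nat.succ_le_of_lt hlt] using hxs.2 m hlt
    · simpa using hx'

theorem exists_norm_reduce_sub_le (hpE : HasInvertibleBlocks p E) (hs : 1 ≤ s)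
    (hγ : IsGaussNodes γ) (hTm : 0 ≤ Tm) (hX : IsSolution p E Tm X) :
    ∃ C, ∀ᶠ h in 𝓝[>] (0 : ℝ), ∀ n : ℕ, n * h ≤ Tm → ∀ xs,
      IsNumericalSolution γ p E h (X 0) n xs → ‖reduce (xs n - X (n * h))‖ ≤ C * h ^ (2 * s) := by
  obtain ⟨ρ, C, -, hC⟩ := exists_norm_sub_le hs (hX.solvesODE hpE) (contDiff_field p) hγ hTm
    (hasBoundedStages_field p γ)
  refine ⟨C, hC.mono fun h hh n hn xs hxs => ?_⟩
  obtain ⟨Y, hseq, -⟩ := hxs.exists_isCollSeq hpE hγ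
  rw [map_sub]
  exact (hh n hn _ Y hseq (congrArg reduce hxs.1)).1 n le_rfl

theorem exists_norm_algebraicPart_sub_le (hpE : HasInvertibleBlocks p E) (hs : 1 ≤ s)
    (hγ : IsGaussNodes γ) (hTm : 0 ≤ Tm) (hX : IsSolution p E Tm X) :
    ∃ C, ∀ᶠ h in 𝓝[>] (0 : ℝ), ∀ n : ℕ, n * h ≤ Tm → ∀ xs,
      IsNumericalSolution γ p E h (X 0) n xs →
        ‖algebraicPart (xs n - X (n * h))‖ ≤ C * h ^ (if Even s then s else s + 1) := by
  have hy := hX.solvesODE hpE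
  have hf := contDiff_field p
  have hb := hasBoundedStages_field p γ
  let P := ContinuousLinearMap.fst ℝ (Fin 4 → ℝ) ((Fin 6 → ℝ) × (Fin 6 → ℝ) × ℝ)
  have hode : ∃ C, ∀ᶠ h in 𝓝[>] (0 : ℝ), ∀ n : ℕ, n * h ≤ Tm → ∀ v Y z,
      IsCollSeq γ (field p) h n v Y → IsAlgebraicSeq γ (field p) P n Y z → v 0 = reduce (X 0) →
        z 0 = P (field p (reduce (X 0))) → ‖z n - P (field p (reduce (X (n * h))))‖ ≤
          C * h ^ (if Even s then s else s + 1) := by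
    by_cases hs2 : Even s
    · simpa only [if_pos hs2] using exists_norm_algebraic_sub_le_of_even hs hs2 hy hf hγ hTm hb P
    · simpa only [if_neg hs2] using
        exists_norm_algebraic_sub_le_of_odd hs (Nat.not_even_iff_odd.mp hs2) hy hf hγ hTm hb P
  obtain ⟨C, hC⟩ := hode
  refine ⟨C, ?_⟩
  filter_upwards [hC, self_mem_nhdsWithin] with h hh (h0 : 0 < h) n hn xs hxs
  obtain ⟨Y, hseq, halg⟩ := hxs.exists_isCollSeq hpE hγ
  have hinit : algebraicPart (xs 0) = (field p (reduce (X 0))).1 := by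
    rw [hxs.1, hX.algebraicPart_eq hpE ⟨le_rfl, hTm⟩]
  rw [map_sub, hX.algebraicPart_eq hpE ⟨by positivity, hn⟩]
  exact hh n hn _ Y _ hseq halg (congrArg reduce hxs.1) hinit

theorem eventually_exists_isNumericalSolution (hpE : HasInvertibleBlocks p E) (hs : 1 ≤ s)
    (hγ : IsGaussNodes γ) (hTm : 0 ≤ Tm) (hX : IsSolution p E Tm X) :
    ∀ᶠ h in 𝓝[>] (0 : ℝ), ∀ n : ℕ, n * h ≤ Tm →
      ∃ xs, IsNumericalSolution γ p E h (X 0) n xs := by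
  obtain ⟨C, hC⟩ := exists_norm_reduce_sub_le hpE hs hγ hTm hX
  obtain ⟨ρ, hρ⟩ := (hX.solvesODE hpE).exists_norm_comp_le (φ := id) continuous_id
  have hCh : ∀ᶠ h in 𝓝[>] (0 : ℝ), C * h ^ (2 * s) ≤ 1 := by
    have hlim : Tendsto (fun h : ℝ => C * h ^ (2 * s)) (𝓝 0) (𝓝 (C * 0 ^ (2 * s))) :=
      (continuous_const.mul (continuous_pow _)).tendsto 0
    rw [zero_pow (by omega), mul_zero] at hlim
    exact nhdsWithin_le_nhds (hlim.eventually (eventually_le_nhds one_pos))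
  filter_upwards [hC, hCh, eventually_exists_isStages (contDiff_field p) γ (ρ + 1),
    self_mem_nhdsWithin] with h herr hCh hstages (hh : 0 < h) n hn
  refine exists_isNumericalSolution fun m hm xs hxs => ?_
  have hmTm : m * h ≤ Tm := le_trans (by gcongr) hn
  have hbound : ‖reduce (xs m)‖ ≤ ρ + 1 := by
    rw [← sub_add_cancel (xs m) (X (m * h)), map_add, add_comm ρ]
    exact norm_add_le_of_le ((herr m hmTm xs hxs).trans hCh) (hρ _ ⟨by positivity, hmTm⟩)
  obtain ⟨Y, hY⟩ := hstages _ hbound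
  exact exists_isStep hpE hγ hh.ne' hY

end Method

end Generator

end

theorem theorem1_general (p : Generator.Params) (E : Matrix (Fin 6) (Fin 6) ℝ)
    (hpE : Generator.HasInvertibleBlocks p E)
    (s : ℕ) (hs : 1 ≤ s) (γ : Fin s → ℝ) (hγ : Generator.IsGaussNodes γ)
    (Tm : ℝ) (hTm : 0 ≤ Tm)
    (X : ℝ → Generator.State) (hX : Generator.IsSolution p E Tm X) :
    ∃ h₀ > 0, ∃ C : ℝ, ∀ h : ℝ, 0 < h → h ≤ h₀ → ∀ n : ℕ, n * h ≤ Tm →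
      (∃ xs : ℕ → Generator.State, Generator.IsNumericalSolution γ p E h (X 0) n xs) ∧
      ∀ xs : ℕ → Generator.State, Generator.IsNumericalSolution γ p E h (X 0) n xs →
        ‖(xs n).Psi - (X (n * h)).Psi‖ ≤ C * h ^ (2 * s) ∧
        ‖(xs n).dTheta - (X (n * h)).dTheta‖ ≤ C * h ^ (2 * s) ∧
        ‖(xs n).Theta - (X (n * h)).Theta‖ ≤ C * h ^ (2 * s) ∧
        (Even s → ‖(xs n).dPsi - (X (n * h)).dPsi‖ ≤ C * h ^ s) ∧
        (Odd s → ‖(xs n).dPsi - (X (n * h)).dPsi‖ ≤ C * h ^ (s + 1)) := by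
  obtain ⟨C₁, hdiff⟩ := Generator.exists_norm_reduce_sub_le hpE hs hγ hTm hX
  obtain ⟨C₂, halg⟩ := Generator.exists_norm_algebraicPart_sub_le hpE hs hγ hTm hX
  have hexists := Generator.eventually_exists_isNumericalSolution hpE hs hγ hTm hX
  obtain ⟨h₀, hh₀, hsmall⟩ := mem_nhdsGT_iff_exists_Ioc_subset.mp (hdiff.and (halg.and hexists))
  refine ⟨h₀, hh₀, max C₁ C₂, fun h h0 hle n hn => ?_⟩
  obtain ⟨hdiff, halg, hexists⟩ := hsmall ⟨h0, hle⟩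
  refine ⟨hexists n hn, fun xs hxs => ?_⟩
  have hreduce := (hdiff n hn xs hxs).trans (mul_le_mul_of_nonneg_right (le_max_left C₁ C₂)
    (by positivity))
  have hdPsi := (halg n hn xs hxs).trans (mul_le_mul_of_nonneg_right (le_max_right C₁ C₂)
    (by positivity))
  refine ⟨(Generator.norm_Psi_le _).trans hreduce, (Generator.norm_dTheta_le _).trans hreduce,
    (Generator.norm_Theta_le _).trans hreduce, fun hs2 => ?_, fun hs2 => ?_⟩
  · rwa [if_pos hs2] at hdPsi
  · rwa [if_neg (Nat.not_even_iff_odd.mpr hs2)] at hdPsi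

theorem theorem1 (p : Generator.Params) (hp : p.Admissible)
    (E : Matrix (Fin 6) (Fin 6) ℝ) (hE : IsUnit E.det) (hEsymm : E.IsSymm)
    (s : ℕ) (hs : 1 ≤ s) (γ : Fin s → ℝ) (hγ : Generator.IsGaussNodes γ)
    (Tm : ℝ) (hTm : 0 < Tm)
    (x0 : Generator.State) (hx0 : Generator.IsConsistent p x0)
    (X : ℝ → Generator.State) (hX : Generator.IsSolution p E Tm X) (hX0 : X 0 = x0) :
    ∃ h₀ > 0, ∃ C : ℝ, ∀ h : ℝ, 0 < h → h ≤ h₀ → ∀ n : ℕ, n * h ≤ Tm →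
      (∃ xs : ℕ → Generator.State, Generator.IsNumericalSolution γ p E h x0 n xs) ∧
      ∀ xs : ℕ → Generator.State, Generator.IsNumericalSolution γ p E h x0 n xs →
        ‖(xs n).Psi - (X (n * h)).Psi‖ ≤ C * h ^ (2 * s) ∧
        ‖(xs n).dTheta - (X (n * h)).dTheta‖ ≤ C * h ^ (2 * s) ∧
        ‖(xs n).Theta - (X (n * h)).Theta‖ ≤ C * h ^ (2 * s) ∧
        (Even s → ‖(xs n).dPsi - (X (n * h)).dPsi‖ ≤ C * h ^ s) ∧
        (Odd s → ‖(xs n).dPsi - (X (n * h)).dPsi‖ ≤ C * h ^ (s + 1)) := by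
  subst hX0
  exact theorem1_general p E (hp.hasInvertibleBlocks hE) s hs γ hγ Tm hTm.le X hX
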